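/- **Setting.** All manifolds are smooth, finite dimensional and Hausdorff, and "smooth" means $C^\infty$. Let $p:E\to M$ be a smooth fibre bundle with standard fibre $S$ and non-empty fibres, and let $(H,\eta)$ be a *system of vector fields* on $E$: $H\to M$ is a smooth vector bundle of finite rank, and $\eta:H\times_M E\to TE$ is a smooth map with $\eta(h,u)\in T_uE$ which is linear in $h$ and satisfies $Tp\,(\eta(h,u))=\underline\eta(h)$ for a smooth, fibrewise surjective vector bundle homomorphism $\underline\eta:H\to TM$ over $M$. (The system need not be strong or complete.) The *bundle of $H$-connections* is the affine bundle $$p_C:C(H)=\{s_x\in L(T_xM,H_x):\underline\eta_x\circ s_x=\mathrm{Id}_{T_xM},\ x\in M\}\to M .$$ A smooth section $\sigma$ of $C(H)$ gives the connection on $E$ with horizontal lift $C_\sigma(\xi_x,u_x)=\eta(\sigma(x)\xi_x,u_x)$ and vertical projection $\Phi_\sigma(Y)=Y-\eta(\sigma(x)(Tp\,Y),u_x)$ for $Y\in T_{u_x}E$. The *universal connection* is the connection on the bundle $C(H)\times_M E\to C(H)$ with vertical projection $$\Phi^{\rm univ}(X,Y)=\bigl(s,\;Y-\eta(s(Tp_C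 X),u)\bigr),\qquad (X,Y)\in T_{(s,u)}(C(H)\times_M E)=T_sC(H)\times_{TM}T_uE .$$ For a connection with vertical projection $\Phi$ on a bundle $Q\to B$ and a piecewise smooth curve $b:[0,1]\to B$, the parallel transport $\mathrm{Pt}(b,t)$, $t\in[0,1]$, is the partially defined map from the fibre over $b(0)$ to the fibre over $b(t)$ which sends $y$ to $\gamma(t)$, where $\gamma:[0,t]\to Q$ is a continuous, piecewise smooth curve which covers $b|_{[0,t]}$, has $\gamma(0)=y$, and is horizontal, i.e. $\Phi(\gamma'(r))=0$ for all but finitely many $r$; it is defined at $y$ if such a $\gamma$ exists. Let $\mathrm{Pt}^\sigma$ and $\mathrm{Pt}^{\rm univ}$ be the parallel transports of $C_\sigma$ and of the universal connection. Let $\sigma\times_ME:E\to C(H)\times_ME$ be the map $u_x\mapsto(\sigma(x),u_x)$ and $\mathrm{pr}_2:C(H)\times_ME\to E$ the second projection. **Lemma 4.5.** Let $\sigma$ be a smooth section of $C(H)$, let $c:[0,1]\to M$ be a (piecewise) smooth curve and let $t\in[0,1]$. Then $$\mathrm{Pt}^{\rm univ}(\sigma\circ c,t)\circ(\sigma\times_ME)=(\sigma\times_ME)\circ\mathrm{Pt}^\sigma(c,t)\quad\text{on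 }E_{c(0)},$$ $$\mathrm{pr}_2\circ\mathrm{Pt}^{\rm univ}(\sigma\circ c,t)=\mathrm{Pt}^\sigma(c,t)\circ\mathrm{pr}_2\quad\text{on }(C(H)\times_ME)_{\sigma(c(0))},$$ as equalities of partially defined maps: in each equation the two sides are defined at the same points, and they agree there. -/

import Mathlib

open Bundle Set Topology
open scoped Manifold ContDiff Bundle

noncomputable section

section FibreBundles

variable {EB HB B ES HS S : Type*}
  [NormedAddCommGroup EB] [NormedSpace ℝ EB] [TopologicalSpace HB]
  [TopologicalSpace B] [ChartedSpace HB B]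
  [NormedAddCommGroup ES] [NormedSpace ℝ ES] [TopologicalSpace HS]
  [TopologicalSpace S] [ChartedSpace HS S]

/-- The total space of a fibre bundle with base `B` and standard fibre `S` (both manifolds) is
charted by composing the local trivializations with products of charts of `B` and of `S`. -/
instance (priority := low) fibreBundleChartedSpace
    (E : B → Type*) [TopologicalSpace (TotalSpace S E)] [∀ x, TopologicalSpace (E x)]
    [FiberBundle S E] : ChartedSpace (ModelProd HB HS) (TotalSpace S E) :=
  ChartedSpace.comp _ (B × S) _

/-- A smooth fibre bundle: the transition maps of the bundle atlas, as maps between open subsets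
of `B × S`, are smooth. -/
class SmoothFibreBundle (IB : ModelWithCorners ℝ EB HB) (IS : ModelWithCorners ℝ ES HS)
    (S : Type*) [TopologicalSpace S] [ChartedSpace HS S] (E : B → Type*) [TopologicalSpace (TotalSpace S E)] [∀ x, TopologicalSpace (E x)]
    [FiberBundle S E] : Prop where
  contMDiffOn_transition : ∀ (e e' : Trivialization S (π S E)) [MemTrivializationAtlas e]
    [MemTrivializationAtlas e'], ContMDiffOn (IB.prod IS) (IB.prod IS) ∞
      (fun y => e' (e.toOpenPartialHomeomorph.symm y))
      (e.toOpenPartialHomeomorph.symm ≫ₕ e'.toOpenPartialHomeomorph).source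

instance SmoothFibreBundle.isManifold
    (IB : ModelWithCorners ℝ EB HB) (IS : ModelWithCorners ℝ ES HS)
    [IsManifold IB ∞ B] [IsManifold IS ∞ S]
    (E : B → Type*) [TopologicalSpace (TotalSpace S E)] [∀ x, TopologicalSpace (E x)]
    [FiberBundle S E] [SmoothFibreBundle IB IS S E] :
    IsManifold (IB.prod IS) ∞ (TotalSpace S E) := by
  refine isManifold_of_contDiffOn _ _ _ ?_
  rintro _ _ ⟨_, ⟨e, he, rfl⟩, f, hf, rfl⟩ ⟨_, ⟨e', he', rfl⟩, f', hf', rfl⟩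
  have : MemTrivializationAtlas e := ⟨he⟩
  have : MemTrivializationAtlas e' := ⟨he'⟩
  rw [← contMDiffOn_iff_contDiffOn]
  have h1 : ContMDiffOn (IB.prod IS) (IB.prod IS) ∞ f' f'.source :=
    contMDiffOn_of_mem_maximalAtlas (IsManifold.subset_maximalAtlas hf')
  have h2 : ContMDiffOn (IB.prod IS) (IB.prod IS) ∞ f.symm f.target :=
    contMDiffOn_symm_of_mem_maximalAtlas (IsManifold.subset_maximalAtlas hf)
  have h3 := SmoothFibreBundle.contMDiffOn_transition (IB := IB) (IS := IS) e e'
  have h4 : ContMDiff (IB.prod IS) 𝓘(ℝ, EB × ES) ∞ (IB.prod IS) :=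
    (IB.prod IS).contMDiff
  have h5 : ContMDiffOn 𝓘(ℝ, EB × ES) (IB.prod IS) ∞ (IB.prod IS).symm (range (IB.prod IS)) :=
    (IB.prod IS).contMDiffOn_symm
  have h6 := h4.comp_contMDiffOn (s := (IB.prod IS).symm ⁻¹' ((e.toOpenPartialHomeomorph ≫ₕ f).symm ≫ₕ
      (e'.toOpenPartialHomeomorph ≫ₕ f')).source ∩ range (IB.prod IS))
    (h1.comp (h3.comp (h2.comp (h5.mono inter_subset_right) ?_) ?_) ?_)
  · exact h6
  · rintro x ⟨hx, -⟩
    simp only [mfld_simps] at hx ⊢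
    tauto
  · rintro x ⟨hx, -⟩
    simp only [mfld_simps] at hx ⊢
    tauto
  · rintro x ⟨hx, -⟩
    simp only [mfld_simps] at hx ⊢
    tauto

theorem SmoothFibreBundle.contMDiff_proj
    (IB : ModelWithCorners ℝ EB HB) (IS : ModelWithCorners ℝ ES HS)
    [IsManifold IB ∞ B] [IsManifold IS ∞ S]
    (E : B → Type*) [TopologicalSpace (TotalSpace S E)] [∀ x, TopologicalSpace (E x)]
    [FiberBundle S E] [SmoothFibreBundle IB IS S E] :
    ContMDiff (IB.prod IS) IB ∞ (fun u : TotalSpace S E => u.proj) := by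
  intro z
  have h1 : ContMDiffOn (IB.prod IS) (IB.prod IS) ∞ (chartAt (ModelProd HB HS) z)
      (chartAt (ModelProd HB HS) z).source := contMDiffOn_chart
  have h2 : ContMDiff (IB.prod IS) IB ∞ (fun y : ModelProd HB HS => y.1) := by
    have := contMDiff_fst (I := IB) (J := IS) (M := HB) (N := HS) (n := ∞)
    rwa [chartedSpaceSelf_prod] at this
  have h3 : ContMDiffOn IB IB ∞ (chartAt HB z.proj).symm (chartAt HB z.proj).target :=
    contMDiffOn_chart_symm
  have hz := mem_chart_source (ModelProd HB HS) z
  set e := trivializationAt S E z.proj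
  have hbase : z.proj ∈ e.baseSet := mem_baseSet_trivializationAt S E z.proj
  have hchart : ∀ u ∈ (chartAt (ModelProd HB HS) z).source,
      u.proj ∈ (chartAt HB z.proj).source ∧ (chartAt (ModelProd HB HS) z u).1 =
        chartAt HB z.proj u.proj := by
    intro u hu
    have hez : (e z).1 = z.proj := e.coe_fst' hbase
    obtain ⟨hu1, hu2⟩ := hu
    have heu : (e u).1 = u.proj := e.coe_fst hu1
    have hu3 : (e u).1 ∈ (chartAt HB (e z).1).source := hu2.1
    refine ⟨by rwa [heu, hez] at hu3, ?_⟩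
    change chartAt HB (e z).1 (e u).1 = _
    rw [heu, hez]
  have h4 := h3.comp (h2.comp_contMDiffOn h1) (fun u hu => by
    obtain ⟨k1, k2⟩ := hchart u hu
    change (chartAt (ModelProd HB HS) z u).1 ∈ (chartAt HB z.proj).target
    rw [k2]
    exact (chartAt HB z.proj).map_source k1)
  refine (h4.contMDiffAt ((chartAt _ z).open_source.mem_nhds hz)).congr_of_eventuallyEq ?_
  filter_upwards [(chartAt (ModelProd HB HS) z).open_source.mem_nhds hz] with u hu
  obtain ⟨k1, k2⟩ := hchart u hu
  change _ = (chartAt HB z.proj).symm (chartAt (ModelProd HB HS) z u).1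
  rw [k2, (chartAt HB z.proj).left_inv k1]

/-- The projection of a smooth fibre bundle as a smooth map. -/
def bundleProj (IB : ModelWithCorners ℝ EB HB) (IS : ModelWithCorners ℝ ES HS)
    [IsManifold IB ∞ B] [IsManifold IS ∞ S]
    (E : B → Type*) [TopologicalSpace (TotalSpace S E)] [∀ x, TopologicalSpace (E x)]
    [FiberBundle S E] [SmoothFibreBundle IB IS S E] :
    C^∞⟮IB.prod IS, TotalSpace S E; IB, B⟯ :=
  ⟨fun u => u.proj, SmoothFibreBundle.contMDiff_proj IB IS E⟩

/-- The pullback of a smooth fibre bundle along a smooth map is a smooth fibre bundle. -/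
instance SmoothFibreBundle.pullback
    {EB' HB' B' : Type*} [NormedAddCommGroup EB'] [NormedSpace ℝ EB'] [TopologicalSpace HB']
    [TopologicalSpace B'] [ChartedSpace HB' B']
    (IB : ModelWithCorners ℝ EB HB) (IS : ModelWithCorners ℝ ES HS)
    (IB' : ModelWithCorners ℝ EB' HB')
    (E : B → Type*) [TopologicalSpace (TotalSpace S E)] [∀ x, TopologicalSpace (E x)]
    [∀ x, Nonempty (E x)]
    [FiberBundle S E] [SmoothFibreBundle IB IS S E] (f : C^∞⟮IB', B'; IB, B⟯) :
    SmoothFibreBundle IB' IS S ((f : B' → B) *ᵖ E) where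
  contMDiffOn_transition := by
    rintro _ _ ⟨e, he, rfl⟩ ⟨e', he', rfl⟩
    have h3 := SmoothFibreBundle.contMDiffOn_transition (IB := IB) (IS := IS) e e'
    have h0 : ContMDiff (IB'.prod IS) (IB.prod IS) ∞ (fun y : B' × S => (f y.1, y.2)) :=
      (f.contMDiff.comp contMDiff_fst).prodMk contMDiff_snd
    have h1 : ContMDiff (IB'.prod IS) IB' ∞ (fun y : B' × S => y.1) := contMDiff_fst
    have key : ∀ y ∈ ((e.pullback f).toOpenPartialHomeomorph.symm ≫ₕ
        (e'.pullback f).toOpenPartialHomeomorph).source,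
        f y.1 ∈ e.baseSet ∧ f y.1 ∈ e'.baseSet := by
      rintro y ⟨hy1, hy2⟩
      have hy1' : f y.1 ∈ e.baseSet := hy1.1
      refine ⟨hy1', ?_⟩
      have hy3 : Pullback.lift f (TotalSpace.mk' S y.1 (e.symm (f y.1) y.2) :
        TotalSpace S ((f : B' → B) *ᵖ E)) ∈ e'.source := hy2
      exact e'.mem_source.mp hy3
    have hs : ∀ y ∈ ((e.pullback f).toOpenPartialHomeomorph.symm ≫ₕ
        (e'.pullback f).toOpenPartialHomeomorph).source,
        (f y.1, y.2) ∈ (e.toOpenPartialHomeomorph.symm ≫ₕ e'.toOpenPartialHomeomorph).source := by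
      intro y hy
      obtain ⟨k1, k2⟩ := key y hy
      have : (f y.1, y.2) ∈ e.target := e.mem_target.mpr k1
      refine ⟨this, ?_⟩
      have h5 := e.proj_symm_apply this
      refine e'.mem_source.mpr ?_
      change (e.toOpenPartialHomeomorph.symm (f y.1, y.2)).proj ∈ e'.baseSet
      rw [h5]
      exact k2
    refine (h1.contMDiffOn.prodMk
      (contMDiff_snd.comp_contMDiffOn (h3.comp h0.contMDiffOn hs))).congr ?_
    intro y hy
    obtain ⟨k1, k2⟩ := key y hy
    refine Prod.ext rfl ?_
    change (e' (Pullback.lift f (TotalSpace.mk' S y.1 (e.symm (f y.1) y.2) :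
      TotalSpace S ((f : B' → B) *ᵖ E)))).2 = (e' (e.toOpenPartialHomeomorph.symm (f y.1, y.2))).2
    rw [Pullback.lift_mk, e.mk_symm k1]

end FibreBundles

lemma contMDiffOn_clm_of_apply {F G EN HN N : Type*}
    [NormedAddCommGroup F] [NormedSpace ℝ F] [FiniteDimensional ℝ F] [NormedAddCommGroup G] [NormedSpace ℝ G]
    [NormedAddCommGroup EN] [NormedSpace ℝ EN] [TopologicalSpace HN]
    {I : ModelWithCorners ℝ EN HN} [TopologicalSpace N] [ChartedSpace HN N]
    {g : N → F →L[ℝ] G} {U : Set N}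
    (h : ∀ v, ContMDiffOn I 𝓘(ℝ, G) ∞ (fun y => g y v) U) :
    ContMDiffOn I 𝓘(ℝ, F →L[ℝ] G) ∞ g U := by
  let b := Module.finBasis ℝ F
  let β : Fin (Module.finrank ℝ F) → (G →L[ℝ] F →L[ℝ] G) := fun i =>
    ContinuousLinearMap.smulRightL ℝ F G (LinearMap.toContinuousLinearMap (b.coord i))
  have hg : g = fun y => ∑ i, β i (g y (b i)) := by
    funext y
    ext v
    conv_lhs => rw [← b.sum_repr v, map_sum]
    simp [β]
  rw [hg]
  refine contMDiffOn_finsetSum fun i _ => ?_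
  exact (β i).contMDiff.comp_contMDiffOn (h (b i))

section ConnectionBundle

set_option linter.unusedSectionVars false

variable {EM M F : Type*}
  [NormedAddCommGroup EM] [NormedSpace ℝ EM] [FiniteDimensional ℝ EM]
  [TopologicalSpace M] [ChartedSpace EM M] [IsManifold 𝓘(ℝ, EM) ∞ M]
  [NormedAddCommGroup F] [NormedSpace ℝ F] [FiniteDimensional ℝ F]
  {V : M → Type*} [∀ x, AddCommGroup (V x)] [∀ x, Module ℝ (V x)] [∀ x, TopologicalSpace (V x)]
  [TopologicalSpace (TotalSpace F V)] [FiberBundle F V] [VectorBundle ℝ F V]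
  [ContMDiffVectorBundle ∞ F V 𝓘(ℝ, EM)]

variable (EM F V) in
/-- A smooth, fibrewise surjective vector bundle homomorphism `H → TM`, where the vector bundle
`H` over `M` has fibres `V x`. -/
structure Anchor where
  /-- the homomorphism on the fibres -/
  ρ : ∀ x : M, V x →L[ℝ] TangentSpace 𝓘(ℝ, EM) x
  smooth_ρ : ContMDiff (𝓘(ℝ, EM).prod 𝓘(ℝ, F)) 𝓘(ℝ, EM).tangent ∞
    (fun h : TotalSpace F V => (⟨h.proj, ρ h.proj h.2⟩ : TangentBundle 𝓘(ℝ, EM) M))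
  surjective_ρ : ∀ x, Function.Surjective (ρ x)

/-- The fibre `C(H)_x = {s ∈ L(T_x M, H_x) | ρ_x ∘ s = id}` of the bundle of connections. -/
@[ext]
structure ConnFibre (A : Anchor EM F V) (x : M) where
  /-- the linear map `T_x M → H_x` -/
  hom : TangentSpace 𝓘(ℝ, EM) x →L[ℝ] V x
  ρ_comp_hom : (A.ρ x).comp hom = ContinuousLinearMap.id ℝ (TangentSpace 𝓘(ℝ, EM) x)

variable (EM F) in
/-- A model of the standard fibre of the kernel of `H → TM`. -/
abbrev KerModel := EuclideanSpace ℝ (Fin (Module.finrank ℝ F - Module.finrank ℝ EM))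

variable (EM F) in
/-- The standard fibre of the bundle of connections. -/
abbrev ConnModel := EM →L[ℝ] KerModel EM F

namespace Anchor

variable (A : Anchor EM F V)

/-- The anchor at `x` read in the bundle charts of `H` and `TM` at `x₀`. -/
def coord (x₀ x : M) : F →L[ℝ] EM :=
  ((trivializationAt EM (TangentSpace 𝓘(ℝ, EM)) x₀).continuousLinearMapAt ℝ x).comp
    ((A.ρ x).comp ((trivializationAt F V x₀).symmL ℝ x))

/-- The common domain of the two bundle charts at `x₀`. -/
def chartDom (_ : Anchor EM F V) (x₀ : M) : Set M :=
  (trivializationAt EM (TangentSpace 𝓘(ℝ, EM) : M → Type _) x₀).baseSet ∩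
    (trivializationAt F V x₀).baseSet

/-- The set of `x` in the common domain at which `(ρ, P)`, read in the bundle charts at `x₀`, is an
isomorphism `F → EM × K`; over it a right inverse `s` of `ρ` is determined by `P ∘ s`, which can be
prescribed arbitrarily. -/
def dom (x₀ : M) (P : F →L[ℝ] KerModel EM F) : Set M :=
  {x | x ∈ A.chartDom x₀ ∧ ((A.coord x₀ x).prod P).IsInvertible}

/-- The right inverse `s` of `ρ` at `x` with coordinate `P ∘ s = a`. -/
def ofCoord (x₀ : M) (P : F →L[ℝ] KerModel EM F) (x : M) (a : ConnModel EM F) :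
    TangentSpace 𝓘(ℝ, EM) x →L[ℝ] V x :=
  ((trivializationAt F V x₀).symmL ℝ x).comp
    ((((A.coord x₀ x).prod P).inverse.comp ((ContinuousLinearMap.id ℝ EM).prod a)).comp
      ((trivializationAt EM (TangentSpace 𝓘(ℝ, EM)) x₀).continuousLinearMapAt ℝ x))

/-- The coordinate `P ∘ s` of `s ∈ L(T_x M, H_x)`, read in the bundle charts at `x₀`. -/
def toCoord (_ : Anchor EM F V) (x₀ : M) (P : F →L[ℝ] KerModel EM F) (x : M) (s : TangentSpace 𝓘(ℝ, EM) x →L[ℝ] V x) :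
    ConnModel EM F :=
  P.comp (((trivializationAt F V x₀).continuousLinearMapAt ℝ x).comp
    (s.comp ((trivializationAt EM (TangentSpace 𝓘(ℝ, EM)) x₀).symmL ℝ x)))

variable {A} {x₀ x : M} {P : F →L[ℝ] KerModel EM F}

lemma ρ_comp_ofCoord (hx : x ∈ A.dom x₀ P) (a : ConnModel EM F) :
    (A.ρ x).comp (A.ofCoord x₀ P x a) = ContinuousLinearMap.id ℝ _ := by
  obtain ⟨⟨h1, h2⟩, h3⟩ := hx
  set eT := trivializationAt EM (TangentSpace 𝓘(ℝ, EM) (M := M)) x₀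
  ext ξ
  have key : ∀ w, ((A.coord x₀ x).prod P) (((A.coord x₀ x).prod P).inverse w) = w :=
    fun w => h3.self_apply_inverse w
  have k1 := congrArg Prod.fst (key (eT.continuousLinearMapAt ℝ x ξ,
    a (eT.continuousLinearMapAt ℝ x ξ)))
  have k2 := congrArg (eT.symmL ℝ x) k1
  simp only [ContinuousLinearMap.prod_apply, coord, ContinuousLinearMap.comp_apply] at k2
  rw [eT.symmL_continuousLinearMapAt h1, eT.symmL_continuousLinearMapAt h1] at k2
  exact k2

lemma toCoord_ofCoord (hx : x ∈ A.dom x₀ P) (a : ConnModel EM F) :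
    A.toCoord x₀ P x (A.ofCoord x₀ P x a) = a := by
  obtain ⟨⟨h1, h2⟩, h3⟩ := hx
  set eT := trivializationAt EM (TangentSpace 𝓘(ℝ, EM) (M := M)) x₀
  set eV := trivializationAt F V x₀
  ext1 w
  have key : ∀ w, ((A.coord x₀ x).prod P) (((A.coord x₀ x).prod P).inverse w) = w :=
    fun w => h3.self_apply_inverse w
  have k1 := congrArg Prod.snd (key (w, a w))
  simp only [toCoord, ofCoord, ContinuousLinearMap.comp_apply]
  rw [eT.continuousLinearMapAt_symmL h1, eV.continuousLinearMapAt_symmL h2]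
  exact k1

lemma ofCoord_toCoord (hx : x ∈ A.dom x₀ P) (s : TangentSpace 𝓘(ℝ, EM) x →L[ℝ] V x)
    (hs : (A.ρ x).comp s = ContinuousLinearMap.id ℝ _) :
    A.ofCoord x₀ P x (A.toCoord x₀ P x s) = s := by
  obtain ⟨⟨h1, h2⟩, h3⟩ := hx
  set eT := trivializationAt EM (TangentSpace 𝓘(ℝ, EM) (M := M)) x₀
  set eV := trivializationAt F V x₀
  ext1 ξ
  have key : ∀ w, ((A.coord x₀ x).prod P).inverse (((A.coord x₀ x).prod P) w) = w :=
    fun w => h3.inverse_apply_self w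
  have k1 := congrArg (eV.symmL ℝ x) (key (eV.continuousLinearMapAt ℝ x (s ξ)))
  have hs' : A.ρ x (s ξ) = ξ := by
    simpa using congrArg (fun f => f ξ) hs
  simp only [ContinuousLinearMap.prod_apply, coord, ContinuousLinearMap.comp_apply] at k1
  rw [eV.symmL_continuousLinearMapAt h2, hs'] at k1
  simp only [toCoord, ofCoord, ContinuousLinearMap.comp_apply, ContinuousLinearMap.prod_apply]
  rw [eT.symmL_continuousLinearMapAt h1]
  exact k1


lemma surjective_coord (hx : x ∈ A.chartDom x₀) : Function.Surjective (A.coord x₀ x) := by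
  obtain ⟨h1, h2⟩ := hx
  intro w
  obtain ⟨h, hh⟩ := A.surjective_ρ x
    ((trivializationAt EM (TangentSpace 𝓘(ℝ, EM) (M := M)) x₀).symmL ℝ x w)
  refine ⟨(trivializationAt F V x₀).continuousLinearMapAt ℝ x h, ?_⟩
  simp only [coord, ContinuousLinearMap.comp_apply]
  rw [Trivialization.symmL_continuousLinearMapAt _ h2, hh,
    Trivialization.continuousLinearMapAt_symmL _ h1]

lemma exists_prod_isInvertible (N : F →L[ℝ] EM) (hN : Function.Surjective N) :
    ∃ P : F →L[ℝ] KerModel EM F, (N.prod P).IsInvertible := by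
  obtain ⟨q, hq⟩ := LinearMap.exists_leftInverse_of_injective
    (LinearMap.ker (N : F →ₗ[ℝ] EM)).subtype (Submodule.ker_subtype _)
  have hdim : Module.finrank ℝ EM + Module.finrank ℝ (LinearMap.ker (N : F →ₗ[ℝ] EM)) =
      Module.finrank ℝ F := by
    rw [← LinearMap.finrank_range_add_finrank_ker (N : F →ₗ[ℝ] EM),
      LinearMap.range_eq_top.mpr hN, finrank_top]
  have hK : Module.finrank ℝ (LinearMap.ker (N : F →ₗ[ℝ] EM)) =
      Module.finrank ℝ (KerModel EM F) := by
    rw [finrank_euclideanSpace_fin]; omega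
  let j := LinearEquiv.ofFinrankEq _ _ hK
  let P : F →ₗ[ℝ] KerModel EM F := j.toLinearMap ∘ₗ q
  let T : F →ₗ[ℝ] EM × KerModel EM F := (N : F →ₗ[ℝ] EM).prod P
  have hT : Function.Injective T := by
    rw [injective_iff_map_eq_zero]
    intro v hv
    have hv1 : N v = 0 := congrArg Prod.fst hv
    have hv2 : j (q v) = 0 := congrArg Prod.snd hv
    have hv3 : q v = ⟨v, hv1⟩ := by
      have := congrArg (fun f => f ⟨v, hv1⟩) hq
      simpa using this
    rw [hv3] at hv2
    exact congrArg Subtype.val (j.map_eq_zero_iff.mp hv2)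
  have hfr : Module.finrank ℝ F = Module.finrank ℝ (EM × KerModel EM F) := by
    rw [Module.finrank_prod, ← hK, hdim]
  refine ⟨LinearMap.toContinuousLinearMap P,
    (LinearMap.linearEquivOfInjective T hT hfr).toContinuousLinearEquiv, ?_⟩
  ext v <;> rfl

lemma exists_mem_dom (A : Anchor EM F V) (x : M) :
    ∃ P : F →L[ℝ] KerModel EM F, x ∈ A.dom x P := by
  have h : x ∈ A.chartDom x :=
    ⟨mem_baseSet_trivializationAt _ _ _, mem_baseSet_trivializationAt _ _ _⟩
  obtain ⟨P, hP⟩ := exists_prod_isInvertible _ (surjective_coord h)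
  exact ⟨P, h, hP⟩

lemma contMDiffOn_coord (A : Anchor EM F V) (x₀ : M) :
    ContMDiffOn 𝓘(ℝ, EM) 𝓘(ℝ, F →L[ℝ] EM) ∞ (A.coord x₀) (A.chartDom x₀) := by
  refine contMDiffOn_clm_of_apply fun v => ?_
  set eT := trivializationAt EM (TangentSpace 𝓘(ℝ, EM) : M → Type _) x₀
  set eV := trivializationAt F V x₀
  have h1 : ContMDiffOn 𝓘(ℝ, EM) (𝓘(ℝ, EM).prod 𝓘(ℝ, F)) ∞
      (fun x : M => (⟨x, eV.symmL ℝ x v⟩ : TotalSpace F V)) (A.chartDom x₀) := by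
    have h0 := eV.contMDiffOn_symm (IB := 𝓘(ℝ, EM)) (n := ∞).comp
      (contMDiff_id.prodMk contMDiff_const).contMDiffOn
      (s := A.chartDom x₀) (f := fun x : M => (x, v)) (fun x hx => eV.mem_target.mpr hx.2)
    refine h0.congr fun x hx => ?_
    rw [eV.symmL_apply hx.2]
    exact eV.mk_symm hx.2 v
  have h2 : ContMDiffOn 𝓘(ℝ, EM) 𝓘(ℝ, EM).tangent ∞
      (fun x : M => (⟨x, A.ρ x (eV.symmL ℝ x v)⟩ : TangentBundle 𝓘(ℝ, EM) M)) (A.chartDom x₀) :=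
    A.smooth_ρ.comp_contMDiffOn h1
  have h3 : ContMDiffOn 𝓘(ℝ, EM).tangent (𝓘(ℝ, EM).prod 𝓘(ℝ, EM)) ∞ eT eT.source :=
    eT.contMDiffOn
  have h4 := contMDiff_snd.comp_contMDiffOn
    (h3.comp h2 (fun x hx => eT.mem_source.mpr hx.1))
  refine h4.congr fun x hx => ?_
  simp only [coord, ContinuousLinearMap.comp_apply]
  exact eT.continuousLinearMapAt_apply_of_mem ℝ hx.1 _

lemma contMDiffOn_prod (A : Anchor EM F V) (x₀ : M) (P : F →L[ℝ] KerModel EM F) :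
    ContMDiffOn 𝓘(ℝ, EM) 𝓘(ℝ, F →L[ℝ] EM × KerModel EM F) ∞
      (fun x => (A.coord x₀ x).prod P) (A.chartDom x₀) := by
  refine contMDiffOn_clm_of_apply fun v => ?_
  simp only [ContinuousLinearMap.prod_apply]
  exact ((contMDiffOn_coord A x₀).clm_apply contMDiffOn_const).prodMk_space contMDiffOn_const

lemma contMDiffOn_inverse (A : Anchor EM F V) (x₀ : M) (P : F →L[ℝ] KerModel EM F) :
    ContMDiffOn 𝓘(ℝ, EM) 𝓘(ℝ, EM × KerModel EM F →L[ℝ] F) ∞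
      (fun x => ((A.coord x₀ x).prod P).inverse) (A.dom x₀ P) := by
  intro x hx
  have h := (contMDiffOn_prod A x₀ P).mono (t := A.dom x₀ P) (fun y hy => hy.1) x hx
  exact (hx.2.contDiffAt_map_inverse (n := ∞)).contMDiffAt.comp_contMDiffWithinAt x h

lemma isOpen_dom (A : Anchor EM F V) (x₀ : M) (P : F →L[ℝ] KerModel EM F) :
    IsOpen (A.dom x₀ P) := by
  have ho : IsOpen (A.chartDom x₀) :=
    (Trivialization.open_baseSet _).inter (Trivialization.open_baseSet _)
  exact (contMDiffOn_prod A x₀ P).continuousOn.isOpen_inter_preimage ho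
    (ContinuousLinearEquiv.isOpen (𝕜 := ℝ))

/-- The changes of charts of the bundle of connections are smooth. -/
lemma contMDiffOn_change (A : Anchor EM F V) (x₀ x₁ : M) (P P' : F →L[ℝ] KerModel EM F) :
    ContMDiffOn (𝓘(ℝ, EM).prod 𝓘(ℝ, ConnModel EM F)) 𝓘(ℝ, ConnModel EM F) ∞
      (fun y : M × ConnModel EM F => A.toCoord x₁ P' y.1 (A.ofCoord x₀ P y.1 y.2))
      ((A.dom x₀ P ∩ A.dom x₁ P') ×ˢ univ) := by
  set eT := trivializationAt EM (TangentSpace 𝓘(ℝ, EM) : M → Type _) x₀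
  set eV := trivializationAt F V x₀
  set eT' := trivializationAt EM (TangentSpace 𝓘(ℝ, EM) : M → Type _) x₁
  set eV' := trivializationAt F V x₁
  refine contMDiffOn_clm_of_apply fun w => ?_
  set U : Set M := A.dom x₀ P ∩ A.dom x₁ P'
  have hfst : ContMDiffOn (𝓘(ℝ, EM).prod 𝓘(ℝ, ConnModel EM F)) 𝓘(ℝ, EM) ∞
      (fun y : M × ConnModel EM F => y.1) (U ×ˢ univ) := contMDiffOn_fst
  have hsnd : ContMDiffOn (𝓘(ℝ, EM).prod 𝓘(ℝ, ConnModel EM F)) 𝓘(ℝ, ConnModel EM F) ∞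
      (fun y : M × ConnModel EM F => y.2) (U ×ˢ univ) := contMDiffOn_snd
  have hT : ContMDiffOn 𝓘(ℝ, EM) 𝓘(ℝ, EM) ∞
      (fun x => (eT'.coordChangeL ℝ eT x : EM →L[ℝ] EM) w) U :=
    ((contMDiffOn_coordChangeL (n := ∞) (IB := 𝓘(ℝ, EM)) eT' eT).mono
      (fun x hx => ⟨hx.2.1.1, hx.1.1.1⟩)).clm_apply contMDiffOn_const
  have hV : ContMDiffOn 𝓘(ℝ, EM) 𝓘(ℝ, F →L[ℝ] F) ∞
      (fun x => (eV.coordChangeL ℝ eV' x : F →L[ℝ] F)) U :=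
    (contMDiffOn_coordChangeL (n := ∞) (IB := 𝓘(ℝ, EM)) eV eV').mono
      (fun x hx => ⟨hx.1.1.2, hx.2.1.2⟩)
  have hI := (contMDiffOn_inverse A x₀ P).mono (t := U) inter_subset_left
  have hT' := hT.comp hfst (fun y hy => hy.1)
  have hV' := hV.comp hfst (fun y hy => hy.1)
  have hI' := hI.comp hfst (fun y hy => hy.1)
  have := P'.contMDiff.comp_contMDiffOn
    (hV'.clm_apply (hI'.clm_apply (hT'.prodMk_space (hsnd.clm_apply hT'))))
  refine this.congr ?_
  rintro ⟨x, a⟩ ⟨hx, -⟩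
  have e1 : (eT'.coordChangeL ℝ eT x : EM →L[ℝ] EM) w =
      eT.continuousLinearMapAt ℝ x (eT'.symmL ℝ x w) := by
    rw [eT.continuousLinearMapAt_apply_of_mem ℝ hx.1.1.1, eT'.symmL_apply hx.2.1.1]
    exact eT'.coordChangeL_apply eT ⟨hx.2.1.1, hx.1.1.1⟩ w
  have e2 : ∀ v, (eV.coordChangeL ℝ eV' x : F →L[ℝ] F) v =
      eV'.continuousLinearMapAt ℝ x (eV.symmL ℝ x v) := by
    intro v
    rw [eV'.continuousLinearMapAt_apply_of_mem ℝ hx.2.1.2, eV.symmL_apply hx.1.1.2]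
    exact eV.coordChangeL_apply eV' ⟨hx.1.1.2, hx.2.1.2⟩ v
  simp only [Function.comp_apply]
  rw [e1, e2]
  rfl

instance nonempty_connFibre (A : Anchor EM F V) (x : M) : Nonempty (ConnFibre A x) := by
  obtain ⟨P, hP⟩ := exists_mem_dom A x
  exact ⟨⟨A.ofCoord x P x 0, ρ_comp_ofCoord hP 0⟩⟩

open Classical in
/-- The element of `C(H)_x` with a given coordinate (an arbitrary one outside the chart domain). -/
def mkFibre (A : Anchor EM F V) (x₀ : M) (P : F →L[ℝ] KerModel EM F) (x : M)
    (a : ConnModel EM F) : ConnFibre A x :=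
  if h : x ∈ A.dom x₀ P then ⟨A.ofCoord x₀ P x a, ρ_comp_ofCoord h a⟩ else Classical.arbitrary _

lemma mkFibre_hom (hx : x ∈ A.dom x₀ P) (a : ConnModel EM F) :
    (A.mkFibre x₀ P x a).hom = A.ofCoord x₀ P x a := by
  rw [mkFibre, dif_pos hx]

/-- The local trivialization of the bundle of connections given by a bundle chart of `TM` and of
`H` at `x₀` and by `P`. -/
def pretriv (A : Anchor EM F V) (x₀ : M) (P : F →L[ℝ] KerModel EM F) :
    Pretrivialization (ConnModel EM F) (π (ConnModel EM F) (ConnFibre A)) where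
  toFun s := (s.proj, A.toCoord x₀ P s.proj s.2.hom)
  invFun y := ⟨y.1, A.mkFibre x₀ P y.1 y.2⟩
  source := π (ConnModel EM F) (ConnFibre A) ⁻¹' A.dom x₀ P
  target := A.dom x₀ P ×ˢ univ
  map_source' s hs := ⟨hs, mem_univ _⟩
  map_target' y hy := hy.1
  left_inv' := by
    rintro ⟨x, s⟩ hs
    have hs' : x ∈ A.dom x₀ P := hs
    refine congrArg (TotalSpace.mk x) (ConnFibre.ext ?_)
    rw [mkFibre_hom hs', ofCoord_toCoord hs' _ s.ρ_comp_hom]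
  right_inv' := by
    rintro ⟨x, a⟩ ⟨hx, -⟩
    have hx' : x ∈ A.dom x₀ P := hx
    refine Prod.ext rfl ?_
    change A.toCoord x₀ P x (A.mkFibre x₀ P x a).hom = a
    rw [mkFibre_hom hx', toCoord_ofCoord hx' a]
  open_target := (isOpen_dom A x₀ P).prod isOpen_univ
  baseSet := A.dom x₀ P
  open_baseSet := isOpen_dom A x₀ P
  source_eq := rfl
  target_eq := rfl
  proj_toFun _ _ := rfl

lemma pretriv_change (A : Anchor EM F V) (x₀ x₁ : M) (P P' : F →L[ℝ] KerModel EM F)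
    {y : M × ConnModel EM F} (hy : y.1 ∈ A.dom x₀ P) :
    A.pretriv x₁ P' ((A.pretriv x₀ P).toPartialEquiv.symm y) =
      (y.1, A.toCoord x₁ P' y.1 (A.ofCoord x₀ P y.1 y.2)) := by
  refine Prod.ext rfl ?_
  change A.toCoord x₁ P' y.1 (A.mkFibre x₀ P y.1 y.2).hom = _
  rw [mkFibre_hom hy]

lemma contMDiffOn_pretriv_change (A : Anchor EM F V) (x₀ x₁ : M)
    (P P' : F →L[ℝ] KerModel EM F) :
    ContMDiffOn (𝓘(ℝ, EM).prod 𝓘(ℝ, ConnModel EM F)) (𝓘(ℝ, EM).prod 𝓘(ℝ, ConnModel EM F)) ∞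
      (fun y => A.pretriv x₁ P' ((A.pretriv x₀ P).toPartialEquiv.symm y))
      ((A.dom x₀ P ∩ A.dom x₁ P') ×ˢ univ) :=
  (contMDiffOn_fst.prodMk (contMDiffOn_change A x₀ x₁ P P')).congr
    fun _ hy => pretriv_change A x₀ x₁ P P' hy.1.1

/-- The topology of the affine space `C(H)_x`, read in an affine coordinate. -/
instance topologicalSpace_connFibre (A : Anchor EM F V) (x : M) :
    TopologicalSpace (ConnFibre A x) :=
  TopologicalSpace.induced
    (fun s => A.toCoord x (Classical.choose (exists_mem_dom A x)) x s.hom) inferInstance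

/-- The bundle of connections with its local trivializations. -/
def connPrebundle (A : Anchor EM F V) : FiberPrebundle (ConnModel EM F) (ConnFibre A) where
  pretrivializationAtlas := range fun p : M × (F →L[ℝ] KerModel EM F) => A.pretriv p.1 p.2
  pretrivializationAt x := A.pretriv x (Classical.choose (exists_mem_dom A x))
  mem_base_pretrivializationAt x := Classical.choose_spec (exists_mem_dom A x)
  pretrivialization_mem_atlas x := ⟨(x, _), rfl⟩
  continuous_trivChange := by
    rintro _ ⟨⟨x₁, P'⟩, rfl⟩ _ ⟨⟨x₀, P⟩, rfl⟩
    refine (contMDiffOn_pretriv_change A x₀ x₁ P P').continuousOn.mono ?_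
    rintro y ⟨⟨hy1, -⟩, hy2⟩
    exact ⟨⟨hy1, hy2⟩, mem_univ _⟩
  totalSpaceMk_isInducing x := (isInducing_prodMkRight x).comp ⟨rfl⟩

instance topologicalSpace_connBundle (A : Anchor EM F V) :
    TopologicalSpace (TotalSpace (ConnModel EM F) (ConnFibre A)) :=
  A.connPrebundle.totalSpaceTopology

instance fiberBundle_connBundle (A : Anchor EM F V) :
    FiberBundle (ConnModel EM F) (ConnFibre A) :=
  A.connPrebundle.toFiberBundle

instance smoothFibreBundle_connBundle (A : Anchor EM F V) :
    SmoothFibreBundle 𝓘(ℝ, EM) 𝓘(ℝ, ConnModel EM F) (ConnModel EM F) (ConnFibre A) where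
  contMDiffOn_transition := by
    rintro e e' ⟨⟨_, ⟨⟨x₀, P⟩, rfl⟩, rfl⟩⟩ ⟨⟨_, ⟨⟨x₁, P'⟩, rfl⟩, rfl⟩⟩
    refine (contMDiffOn_pretriv_change A x₀ x₁ P P').mono ?_
    rintro y ⟨⟨hy1, -⟩, hy2⟩
    exact ⟨⟨hy1, hy2⟩, mem_univ _⟩

instance isManifold_connBundle (A : Anchor EM F V) :
    IsManifold (𝓘(ℝ, EM).prod 𝓘(ℝ, ConnModel EM F)) ∞
      (TotalSpace (ConnModel EM F) (ConnFibre A)) :=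
  SmoothFibreBundle.isManifold _ _ _

/-- The bundle of connections `C(H)`. -/
abbrev ConnBundle (A : Anchor EM F V) : Type _ := TotalSpace (ConnModel EM F) (ConnFibre A)

/-- The bundle projection `p_C : C(H) → M`. -/
def connProj (A : Anchor EM F V) :
    C^∞⟮𝓘(ℝ, EM).prod 𝓘(ℝ, ConnModel EM F), A.ConnBundle; 𝓘(ℝ, EM), M⟯ :=
  ⟨fun s => s.proj, contMDiff_proj (ConnFibre A)⟩

end Anchor

end ConnectionBundle

section ParallelTransport

variable {EY HY Y B : Type*} [NormedAddCommGroup EY] [NormedSpace ℝ EY] [TopologicalSpace HY]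
  [TopologicalSpace Y] [ChartedSpace HY Y]

/-- `γ` is continuous on `[0, t]` and smooth on every closed subinterval of `[0, t]` that has no
point of the finite set `K` in its interior. -/
def SmoothOffOn (IY : ModelWithCorners ℝ EY HY) (γ : ℝ → Y) (t : ℝ) (K : Finset ℝ) : Prop :=
  ContinuousOn γ (Icc 0 t) ∧
    ∀ a b : ℝ, 0 ≤ a → a < b → b ≤ t → (∀ k ∈ K, k ∉ Ioo a b) →
      ContMDiffOn 𝓘(ℝ, ℝ) IY ∞ γ (Icc a b)

/-- `γ` restricts to a piecewise smooth curve on `[0, t]`. -/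
def PiecewiseSmooth (IY : ModelWithCorners ℝ EY HY) (γ : ℝ → Y) (t : ℝ) : Prop :=
  ∃ K : Finset ℝ, SmoothOffOn IY γ t K

/-- Let `p : Y → B` be a bundle with a connection whose vertical projection is `Φ` (a one-form on
`Y`, with values in some vector spaces `W y`). The curve `γ` is on `[0, t]` a piecewise smooth
horizontal lift of `c` with initial value `y`: it covers `c`, and `Φ (γ') = 0`
except at finitely many break points. -/
def IsHorizontalLift (IY : ModelWithCorners ℝ EY HY) (p : Y → B)
    {W : Y → Type*} [∀ y, AddCommGroup (W y)] [∀ y, Module ℝ (W y)]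
    [∀ y, TopologicalSpace (W y)] (Φ : ∀ y, TangentSpace IY y →L[ℝ] W y)
    (c : ℝ → B) (t : ℝ) (y : Y) (γ : ℝ → Y) : Prop :=
  γ 0 = y ∧ (∀ r ∈ Icc 0 t, p (γ r) = c r) ∧
    ∃ K : Finset ℝ, SmoothOffOn IY γ t K ∧
      ∀ r ∈ Ioo 0 t, r ∉ K → Φ (γ r) (mfderiv 𝓘(ℝ, ℝ) IY γ r (1 : ℝ)) = 0

/-- The parallel transport `Pt(c, t)` along `c` of the connection with vertical projection `Φ`, as
a partial map: `Pt(c, t, y)` is defined if there is a horizontal lift `γ` of `c` on `[0, t]` with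
`γ 0 = y`, and then it is `γ t`. It is defined only for `y` in the fibre over `c 0`. -/
def parallelTransport (IY : ModelWithCorners ℝ EY HY) (p : Y → B)
    {W : Y → Type*} [∀ y, AddCommGroup (W y)] [∀ y, Module ℝ (W y)]
    [∀ y, TopologicalSpace (W y)] (Φ : ∀ y, TangentSpace IY y →L[ℝ] W y)
    (c : ℝ → B) (t : ℝ) : Y →. Y := fun y =>
  ⟨∃ γ, IsHorizontalLift IY p Φ c t y γ, fun h => Classical.choose h t⟩

end ParallelTransport

section Systems

set_option linter.unusedSectionVars false

variable {EM M F ES S : Type*}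
  [NormedAddCommGroup EM] [NormedSpace ℝ EM] [FiniteDimensional ℝ EM]
  [TopologicalSpace M] [ChartedSpace EM M] [IsManifold 𝓘(ℝ, EM) ∞ M]
  [NormedAddCommGroup F] [NormedSpace ℝ F] [FiniteDimensional ℝ F]
  {V : M → Type*} [∀ x, AddCommGroup (V x)] [∀ x, Module ℝ (V x)] [∀ x, TopologicalSpace (V x)]
  [TopologicalSpace (TotalSpace F V)] [FiberBundle F V] [VectorBundle ℝ F V]
  [ContMDiffVectorBundle ∞ F V 𝓘(ℝ, EM)]
  [NormedAddCommGroup ES] [NormedSpace ℝ ES]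
  [TopologicalSpace S] [ChartedSpace ES S] [IsManifold 𝓘(ℝ, ES) ∞ S]
  {E : M → Type*} [∀ x, TopologicalSpace (E x)] [∀ x, Nonempty (E x)]
  [TopologicalSpace (TotalSpace S E)] [FiberBundle S E]
  [SmoothFibreBundle 𝓘(ℝ, EM) 𝓘(ℝ, ES) S E]

variable (EM F ES S V E) in
/-- A system of vector fields `(H, η)` on the fibre bundle `E → M`: the vector bundle `H` over `M`
has fibres `V x`, `η : H ×_M E → TE` is smooth, fibre respecting and fibrewise linear over `E`, and
it covers (`Tp ∘ η = ρ ∘ pr₁`) a fibrewise surjective vector bundle homomorphism `ρ : H → TM`. -/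
structure VFSystem extends Anchor EM F V where
  /-- the linear map `η(·, u) : H_{p(u)} → T_u E` -/
  η : ∀ u : TotalSpace S E, V u.proj →L[ℝ] TangentSpace (𝓘(ℝ, EM).prod 𝓘(ℝ, ES)) u
  smooth_η : ContMDiff ((𝓘(ℝ, EM).prod 𝓘(ℝ, ES)).prod 𝓘(ℝ, F))
    (𝓘(ℝ, EM).prod 𝓘(ℝ, ES)).tangent ∞
    (fun h : TotalSpace F
        ((bundleProj (S := S) 𝓘(ℝ, EM) 𝓘(ℝ, ES) E : TotalSpace S E → M) *ᵖ V) =>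
      (⟨h.proj, η h.proj h.2⟩ :
        TangentBundle (𝓘(ℝ, EM).prod 𝓘(ℝ, ES)) (TotalSpace S E)))
  proj_η : ∀ (u : TotalSpace S E) (h : V u.proj),
    mfderiv (𝓘(ℝ, EM).prod 𝓘(ℝ, ES)) 𝓘(ℝ, EM) (fun v : TotalSpace S E => v.proj) u (η u h) =
      ρ u.proj h

namespace VFSystem

variable (X : VFSystem EM F ES S V E)

/-- The horizontal lift `C_σ(ξ_x, u_x) = η(σ(ξ_x), u_x)` of the `H`-connection given by the
section `σ` of `C(H)`. -/
def horLift (σ : ∀ x, ConnFibre X.toAnchor x) (u : TotalSpace S E) :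
    TangentSpace 𝓘(ℝ, EM) u.proj →L[ℝ] TangentSpace (𝓘(ℝ, EM).prod 𝓘(ℝ, ES)) u :=
  (X.η u).comp (σ u.proj).hom

/-- The vertical projection `Φ_σ = id - C_σ ∘ Tp` of the connection `C_σ`. -/
def vertProj (σ : ∀ x, ConnFibre X.toAnchor x) (u : TotalSpace S E) :
    TangentSpace (𝓘(ℝ, EM).prod 𝓘(ℝ, ES)) u →L[ℝ]
      TangentSpace (𝓘(ℝ, EM).prod 𝓘(ℝ, ES)) u :=
  ContinuousLinearMap.id ℝ _ - (X.horLift σ u).comp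
    (mfderiv (𝓘(ℝ, EM).prod 𝓘(ℝ, ES)) 𝓘(ℝ, EM) (fun v : TotalSpace S E => v.proj) u)

/-- The parallel transport `Pt^σ` of the connection `C_σ`. -/
def Pt (σ : ∀ x, ConnFibre X.toAnchor x) (c : ℝ → M) (t : ℝ) :
    TotalSpace S E →. TotalSpace S E :=
  parallelTransport (𝓘(ℝ, EM).prod 𝓘(ℝ, ES)) (fun u : TotalSpace S E => u.proj)
    (X.vertProj σ) c t

/-- The fibre bundle `C(H) ×_M E → C(H)`. -/
abbrev ConnPullback : Type _ :=
  TotalSpace S ((X.connProj : X.ConnBundle → M) *ᵖ E)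

/-- The second projection `pr₂ : C(H) ×_M E → E`. -/
def pr₂ : X.ConnPullback → TotalSpace S E := Pullback.lift X.connProj

/-- The vertical projection of the universal connection on `C(H) ×_M E → C(H)`,
`Φ^univ(X, Y) = Y - η(s(Tp_C X), u)` at the point `(s, u)`, where a tangent vector `Z` of
`C(H) ×_M E` corresponds to the pair of `X = T pr₁ Z ∈ T_s C(H)` and `Y = T pr₂ Z ∈ T_u E`
(`T(C(H) ×_M E) = TC(H) ×_{TM} TE`), and vertical vectors at `(s, u)` to vertical vectors of `E` at
`u`. Its kernel is the range of the horizontal lift `C^univ(X, u) = (X, η(s(Tp_C X), u))`. -/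
def univVertProj (z : X.ConnPullback) :
    TangentSpace ((𝓘(ℝ, EM).prod 𝓘(ℝ, ConnModel EM F)).prod 𝓘(ℝ, ES)) z →L[ℝ]
      TangentSpace (𝓘(ℝ, EM).prod 𝓘(ℝ, ES)) (X.pr₂ z) :=
  mfderiv ((𝓘(ℝ, EM).prod 𝓘(ℝ, ConnModel EM F)).prod 𝓘(ℝ, ES)) (𝓘(ℝ, EM).prod 𝓘(ℝ, ES)) X.pr₂ z -
    (X.η (X.pr₂ z)).comp (z.proj.2.hom.comp
      ((mfderiv (𝓘(ℝ, EM).prod 𝓘(ℝ, ConnModel EM F)) 𝓘(ℝ, EM) X.connProj z.proj).comp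
        (mfderiv ((𝓘(ℝ, EM).prod 𝓘(ℝ, ConnModel EM F)).prod 𝓘(ℝ, ES))
          (𝓘(ℝ, EM).prod 𝓘(ℝ, ConnModel EM F)) (fun w : X.ConnPullback => w.proj) z)))

/-- The parallel transport `Pt^univ` of the universal connection. -/
def univPt (b : ℝ → X.ConnBundle) (t : ℝ) : X.ConnPullback →. X.ConnPullback :=
  parallelTransport ((𝓘(ℝ, EM).prod 𝓘(ℝ, ConnModel EM F)).prod 𝓘(ℝ, ES))
    (fun z : X.ConnPullback => z.proj) X.univVertProj b t

/-- The section `σ` as a map `M → C(H)`. -/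
def toBundle (σ : ∀ x, ConnFibre X.toAnchor x) (x : M) : X.ConnBundle := ⟨x, σ x⟩

/-- The extended section `σ ×_M E : E → C(H) ×_M E`, `u_x ↦ (σ(x), u_x)`. -/
def extSection (σ : ∀ x, ConnFibre X.toAnchor x) (u : TotalSpace S E) : X.ConnPullback :=
  ⟨X.toBundle σ u.proj, u.2⟩

end VFSystem

end Systems

end

/-! Over the image of `σ`, the projection `pr₂ : C(H) ×_M E → E` is inverse to `σ ×_M E`, and both
maps are smooth. The square `p ∘ pr₂ = p_C ∘ pr₁` commutes, so `Tp_C X = Tp Y` for a tangent vector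
`(X, Y)` of `C(H) ×_M E`; at a point `(σ(x), u)` this gives `Φ^univ(X, Y) = Y - η(σ(x)(Tp Y), u) =
Φ_σ(Y)` (`univVertProj_eq_vertProj`). Composition with `pr₂` therefore turns horizontal lifts of `σ
∘ c` into horizontal lifts of `c`, and composition with `σ ×_M E` leads back
(`isHorizontalLift_pr₂_iff`). Hence the two transports are defined at corresponding points; no
existence theorem for lifts enters.

The values need one more ingredient. The transport at a point is the end point of some chosen lift,
and the choices on the two sides are unrelated, so uniqueness of lifts is required
(`eq_of_isHorizontalLift`). In charts a horizontal curve solves `w' = Λ(w) x'`, where `x` is the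
base curve and `Λ` is the smooth local expression of `C_σ`. Grönwall's inequality gives uniqueness
on a short interval to the right of any time, break points included (`eventually_eq_of_horizontal`).
Since `E` is Hausdorff, the coincidence set of two lifts is closed, hence all of `[0, t]`.

This gives the first equation (`univPt_extSection`); the second follows from it because `pr₂` and `σ
×_M E` are mutually inverse over the image of `σ`. -/

/-! ### Smooth maps between fibre bundles and their pullbacks -/

section FibreBundleMaps

variable {EB HB B ES HS S : Type*}
  [NormedAddCommGroup EB] [NormedSpace ℝ EB] [TopologicalSpace HB]
  [TopologicalSpace B] [ChartedSpace HB B]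
  [NormedAddCommGroup ES] [NormedSpace ℝ ES] [TopologicalSpace HS]
  [TopologicalSpace S] [ChartedSpace HS S]
  {IB : ModelWithCorners ℝ EB HB} {IS : ModelWithCorners ℝ ES HS}
  {E : B → Type*} [TopologicalSpace (TotalSpace S E)] [∀ x, TopologicalSpace (E x)]
  [FiberBundle S E]

/-- Two points of one fibre lie in the domain of one trivialization and are separated in `B × S`;
points of different fibres are separated in the base. This later makes the coincidence set of two
lifts closed. -/
lemma FiberBundle.t2Space_totalSpace [T2Space B] [T2Space S] : T2Space (TotalSpace S E) := by
  have hsep : IsSeparatedMap (fun u : TotalSpace S E => u.proj) := by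
    intro u v huv hne
    set e := trivializationAt S E u.proj
    have hu : u ∈ e.source := e.mem_source.mpr (mem_baseSet_trivializationAt S E u.proj)
    have hv : v ∈ e.source := e.mem_source.mpr
      (by rw [← show u.proj = v.proj from huv]; exact mem_baseSet_trivializationAt S E u.proj)
    have hne' : e u ≠ e v := fun h => hne (e.injOn hu hv h)
    obtain ⟨s, t, hs, ht, hus, hvt, hst⟩ := t2_separation hne'
    refine ⟨e.source ∩ e ⁻¹' s, e.source ∩ e ⁻¹' t,
      e.continuousOn.isOpen_inter_preimage e.open_source hs,
      e.continuousOn.isOpen_inter_preimage e.open_source ht, ⟨hu, hus⟩, ⟨hv, hvt⟩, ?_⟩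
    exact (hst.preimage e).mono inter_subset_right inter_subset_right
  refine ⟨fun u v hne => ?_⟩
  by_cases huv : u.proj = v.proj
  · exact hsep u v huv hne
  · obtain ⟨s, t, hs, ht, hus, hvt, hst⟩ := t2_separation huv
    exact ⟨_, _, hs.preimage (FiberBundle.continuous_proj S E),
      ht.preimage (FiberBundle.continuous_proj S E), hus, hvt, hst.preimage _⟩

variable [IsManifold IB ∞ B] [IsManifold IS ∞ S] [SmoothFibreBundle IB IS S E]

/-- By construction the chart at `z` is the preferred trivialization `e` followed by the chart of `B
× S` at `e z`; undoing the latter recovers `e`. -/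
lemma SmoothFibreBundle.contMDiffAt_trivializationAt (z : TotalSpace S E) :
    ContMDiffAt (IB.prod IS) (IB.prod IS) ∞ (trivializationAt S E z.proj) z := by
  set e := trivializationAt S E z.proj
  have hz : z ∈ e.source := e.mem_source.mpr (mem_baseSet_trivializationAt S E z.proj)
  have h1 : ContMDiffAt (IB.prod IS) (IB.prod IS) ∞ (chartAt (ModelProd HB HS) z) z :=
    contMDiffOn_chart.contMDiffAt ((chartAt _ z).open_source.mem_nhds (mem_chart_source _ z))
  have h2 : ContMDiffAt (IB.prod IS) (IB.prod IS) ∞ (chartAt (ModelProd HB HS) (e z)).symm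
      (chartAt (ModelProd HB HS) z z) :=
    contMDiffOn_chart_symm.contMDiffAt ((chartAt (ModelProd HB HS) (e z)).open_target.mem_nhds
      ((chartAt (ModelProd HB HS) (e z)).map_source (mem_chart_source _ (e z))))
  refine (h2.comp z h1).congr_of_eventuallyEq ?_
  filter_upwards [(chartAt (ModelProd HB HS) z).open_source.mem_nhds (mem_chart_source _ z)]
    with u hu
  exact ((chartAt (ModelProd HB HS) (e z)).left_inv hu.2).symm

/-- Near `z`, `e` is the preferred trivialization followed by a transition map. -/
lemma SmoothFibreBundle.contMDiffAt_trivialization (e : Trivialization S (π S E))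
    [MemTrivializationAtlas e] {z : TotalSpace S E} (hz : z ∈ e.source) :
    ContMDiffAt (IB.prod IS) (IB.prod IS) ∞ e z := by
  set e₀ := trivializationAt S E z.proj
  have hz₀ : z ∈ e₀.source := e₀.mem_source.mpr (mem_baseSet_trivializationAt S E z.proj)
  have h1 : ContMDiffAt (IB.prod IS) (IB.prod IS) ∞ e₀ z :=
    SmoothFibreBundle.contMDiffAt_trivializationAt z
  have h2 := (SmoothFibreBundle.contMDiffOn_transition (IB := IB) (IS := IS) e₀ e).contMDiffAt
    (x := e₀ z) ((OpenPartialHomeomorph.open_source _).mem_nhds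
      ⟨e₀.map_source hz₀, by
        change e₀.toOpenPartialHomeomorph.symm (e₀ z) ∈ e.source
        exact (congrArg (· ∈ e.source) (e₀.toOpenPartialHomeomorph.left_inv hz₀)).mpr hz⟩)
  refine (h2.comp z h1).congr_of_eventuallyEq ?_
  filter_upwards [e₀.open_source.mem_nhds hz₀] with u hu
  exact (congrArg e (e₀.toOpenPartialHomeomorph.left_inv hu)).symm

lemma SmoothFibreBundle.contMDiffAt_trivialization_symm (e : Trivialization S (π S E))
    [MemTrivializationAtlas e] {y : B × S} (hy : y ∈ e.target) :
    ContMDiffAt (IB.prod IS) (IB.prod IS) ∞ e.toOpenPartialHomeomorph.symm y := by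
  set z := e.toOpenPartialHomeomorph.symm y with hzdef
  have hz : z ∈ e.source := e.toOpenPartialHomeomorph.map_target hy
  set e₀ := trivializationAt S E z.proj
  have hz₀ : z ∈ e₀.source := e₀.mem_source.mpr (mem_baseSet_trivializationAt S E z.proj)
  have hsrc : y ∈ (e.toOpenPartialHomeomorph.symm ≫ₕ e₀.toOpenPartialHomeomorph).source :=
    ⟨hy, hz₀⟩
  have h1 := (SmoothFibreBundle.contMDiffOn_transition (IB := IB) (IS := IS) e e₀).contMDiffAt
    ((OpenPartialHomeomorph.open_source _).mem_nhds hsrc)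
  have h2 : ContMDiffAt (IB.prod IS) (IB.prod IS) ∞ (chartAt (ModelProd HB HS) (e₀ z)) (e₀ z) :=
    contMDiffOn_chart.contMDiffAt ((chartAt _ _).open_source.mem_nhds (mem_chart_source _ _))
  have h3 : ContMDiffAt (IB.prod IS) (IB.prod IS) ∞ (chartAt (ModelProd HB HS) z).symm
      (chartAt (ModelProd HB HS) z z) :=
    contMDiffOn_chart_symm.contMDiffAt ((chartAt (ModelProd HB HS) z).open_target.mem_nhds
      ((chartAt (ModelProd HB HS) z).map_source (mem_chart_source _ z)))
  refine (ContMDiffAt.comp y h3 (ContMDiffAt.comp y h2 h1)).congr_of_eventuallyEq ?_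
  have hc : ContinuousAt e.toOpenPartialHomeomorph.symm y :=
    e.toOpenPartialHomeomorph.symm.continuousAt hy
  filter_upwards [hc ((chartAt (ModelProd HB HS) z).open_source.mem_nhds (mem_chart_source _ z))]
    with u hu
  exact ((chartAt (ModelProd HB HS) z).left_inv hu).symm

variable {EB' HB' B' : Type*} [NormedAddCommGroup EB'] [NormedSpace ℝ EB'] [TopologicalSpace HB']
    [TopologicalSpace B'] [ChartedSpace HB' B']
    {IB' : ModelWithCorners ℝ EB' HB'} [IsManifold IB' ∞ B'] [∀ x, Nonempty (E x)]

/-- Read in the trivializations `e.pullback f` and `e`, this map is `(b, s) ↦ (f b, s)`. -/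
lemma SmoothFibreBundle.contMDiff_pullbackLift (f : C^∞⟮IB', B'; IB, B⟯) :
    ContMDiff (IB'.prod IS) (IB.prod IS) ∞
      (Pullback.lift f : TotalSpace S ((f : B' → B) *ᵖ E) → TotalSpace S E) := by
  intro z
  set e := trivializationAt S E (f z.proj)
  have hb : f z.proj ∈ e.baseSet := mem_baseSet_trivializationAt S E (f z.proj)
  have hz : z ∈ (e.pullback f).source := (e.pullback f).mem_source.mpr hb
  have : MemTrivializationAtlas (e.pullback f) := ⟨⟨e, inferInstance, rfl⟩⟩
  have h1 : ContMDiffAt (IB'.prod IS) (IB'.prod IS) ∞ (e.pullback f) z :=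
    SmoothFibreBundle.contMDiffAt_trivialization _ hz
  have h2 : ContMDiffAt (IB'.prod IS) (IB.prod IS) ∞
      (fun u => (f (e.pullback f u).1, (e.pullback f u).2)) z :=
    (f.contMDiff.contMDiffAt.comp z (contMDiffAt_fst.comp z h1)).prodMk
      (contMDiffAt_snd.comp z h1)
  have h3 : ContMDiffAt (IB.prod IS) (IB.prod IS) ∞ e.toOpenPartialHomeomorph.symm
      (f (e.pullback f z).1, (e.pullback f z).2) :=
    SmoothFibreBundle.contMDiffAt_trivialization_symm e (e.mem_target.mpr hb)
  refine (ContMDiffAt.comp z h3 h2).congr_of_eventuallyEq ?_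
  filter_upwards [(e.pullback f).open_source.mem_nhds hz] with u hu
  have hu' : Pullback.lift f u ∈ e.source := e.mem_source.mpr ((e.pullback f).mem_source.mp hu)
  have hu2 : (f (e.pullback f u).1, (e.pullback f u).2) = e (Pullback.lift f u) :=
    Prod.ext (e.coe_fst hu').symm rfl
  exact ((congrArg e.toOpenPartialHomeomorph.symm hu2).trans
    (e.toOpenPartialHomeomorph.left_inv hu')).symm

/-- A map into a pullback bundle is smooth if its two components are. -/
lemma SmoothFibreBundle.contMDiff_pullback_of_comp {EN HN N : Type*} [NormedAddCommGroup EN]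
    [NormedSpace ℝ EN] [TopologicalSpace HN] [TopologicalSpace N] [ChartedSpace HN N]
    {IN : ModelWithCorners ℝ EN HN} (f : C^∞⟮IB', B'; IB, B⟯)
    {g : N → TotalSpace S ((f : B' → B) *ᵖ E)}
    (h1 : ContMDiff IN IB' ∞ (fun y => (g y).proj))
    (h2 : ContMDiff IN (IB.prod IS) ∞ (fun y => Pullback.lift f (g y))) :
    ContMDiff IN (IB'.prod IS) ∞ g := by
  intro y
  set e := trivializationAt S E (f (g y).proj)
  have hb : f (g y).proj ∈ e.baseSet := mem_baseSet_trivializationAt S E (f (g y).proj)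
  have : MemTrivializationAtlas (e.pullback f) := ⟨⟨e, inferInstance, rfl⟩⟩
  have hy : Pullback.lift f (g y) ∈ e.source := e.mem_source.mpr hb
  have h3 : ContMDiffAt IN (IB.prod IS) ∞ (fun x => e (Pullback.lift f (g x))) y :=
    (SmoothFibreBundle.contMDiffAt_trivialization e hy).comp y h2.contMDiffAt
  -- These are the coordinates of `g` in `e.pullback f`: the fibre coordinate is that of the
  -- component in `E`.
  have h4 : ContMDiffAt IN (IB'.prod IS) ∞
      (fun x => ((g x).proj, (e (Pullback.lift f (g x))).2)) y :=
    h1.contMDiffAt.prodMk (contMDiffAt_snd.comp y h3)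
  have h5 : ContMDiffAt (IB'.prod IS) (IB'.prod IS) ∞ (e.pullback f).toOpenPartialHomeomorph.symm
      ((g y).proj, (e (Pullback.lift f (g y))).2) :=
    SmoothFibreBundle.contMDiffAt_trivialization_symm _ ((e.pullback f).mem_target.mpr hb)
  refine (ContMDiffAt.comp y h5 h4).congr_of_eventuallyEq ?_
  filter_upwards [h2.continuous.continuousAt (e.open_source.mem_nhds hy)] with x hx
  have hx' : g x ∈ (e.pullback f).source := (e.pullback f).mem_source.mpr (e.mem_source.mp hx)
  exact ((e.pullback f).toOpenPartialHomeomorph.left_inv hx').symm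

end FibreBundleMaps

/-! ### The horizontal equation in charts -/

lemma HasMFDerivAt.hasDerivAt_curve {G : Type*} [NormedAddCommGroup G] [NormedSpace ℝ G]
    {g : ℝ → G} {r : ℝ} {D : ℝ →L[ℝ] G} (h : HasMFDerivAt 𝓘(ℝ, ℝ) 𝓘(ℝ, G) g r D) :
    HasDerivAt g (D 1) r := by
  have h' : HasFDerivAt g D r := hasMFDerivAt_iff_hasFDerivAt.mp h
  exact h'.hasDerivAt

section HorizontalLifts

set_option linter.unusedSectionVars false

variable {EM M F ES S : Type*}
  [NormedAddCommGroup EM] [NormedSpace ℝ EM] [FiniteDimensional ℝ EM]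
  [TopologicalSpace M] [ChartedSpace EM M] [IsManifold 𝓘(ℝ, EM) ∞ M]
  [NormedAddCommGroup F] [NormedSpace ℝ F] [FiniteDimensional ℝ F]
  {V : M → Type*} [∀ x, AddCommGroup (V x)] [∀ x, Module ℝ (V x)] [∀ x, TopologicalSpace (V x)]
  [TopologicalSpace (TotalSpace F V)] [FiberBundle F V] [VectorBundle ℝ F V]
  [ContMDiffVectorBundle ∞ F V 𝓘(ℝ, EM)]
  [NormedAddCommGroup ES] [NormedSpace ℝ ES]
  [TopologicalSpace S] [ChartedSpace ES S] [IsManifold 𝓘(ℝ, ES) ∞ S]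
  {E : M → Type*} [∀ x, TopologicalSpace (E x)]
  [TopologicalSpace (TotalSpace S E)] [FiberBundle S E]
  [SmoothFibreBundle 𝓘(ℝ, EM) 𝓘(ℝ, ES) S E]

/-- A smooth section of `C(H)` maps a local vector field with constant coordinates to a smooth
local section of `H`. -/
lemma Anchor.exists_contMDiffOn_hom_symmL (A : Anchor EM F V) (σ : ∀ x, ConnFibre A x)
    (hσ : ContMDiff 𝓘(ℝ, EM) (𝓘(ℝ, EM).prod 𝓘(ℝ, ConnModel EM F)) ∞
      (fun x => (⟨x, σ x⟩ : A.ConnBundle))) (x₀ : M) :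
    ∃ U : Set M, IsOpen U ∧ x₀ ∈ U ∧
      ∀ v : EM, ContMDiffOn 𝓘(ℝ, EM) (𝓘(ℝ, EM).prod 𝓘(ℝ, F)) ∞
        (fun x => (⟨x, (σ x).hom ((trivializationAt EM (TangentSpace 𝓘(ℝ, EM)) x₀).symmL ℝ x v)⟩ :
          TotalSpace F V)) U := by
  -- This is the `P` used by the preferred trivialization of `C(H)` at `x₀`, whose fibre coordinate
  -- is thus `toCoord x₀ P`.
  obtain ⟨P, hP⟩ : ∃ P, P = Classical.choose (exists_mem_dom A x₀) := ⟨_, rfl⟩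
  have hx₀ : x₀ ∈ A.dom x₀ P := hP ▸ Classical.choose_spec (exists_mem_dom A x₀)
  refine ⟨A.dom x₀ P, isOpen_dom A x₀ P, hx₀, fun v => ?_⟩
  set eT := trivializationAt EM (TangentSpace 𝓘(ℝ, EM) : M → Type _) x₀
  set eV := trivializationAt F V x₀
  have ha : ContMDiffOn 𝓘(ℝ, EM) 𝓘(ℝ, ConnModel EM F) ∞
      (fun x => A.toCoord x₀ P x (σ x).hom) (A.dom x₀ P) := by
    intro x hx
    have h1 := SmoothFibreBundle.contMDiffAt_trivialization (IB := 𝓘(ℝ, EM))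
      (IS := 𝓘(ℝ, ConnModel EM F)) (trivializationAt (ConnModel EM F) (ConnFibre A) x₀)
      (z := (⟨x, σ x⟩ : A.ConnBundle)) (by subst hP; exact hx)
    have h2 := contMDiffAt_snd.comp x (h1.comp x hσ.contMDiffAt)
    subst hP
    exact h2.contMDiffWithinAt
  have hI := (contMDiffOn_inverse A x₀ P).clm_apply
    ((contMDiffOn_const (c := v)).prodMk_space (ha.clm_apply (contMDiffOn_const (c := v))))
  have h0 := eV.contMDiffOn_symm (IB := 𝓘(ℝ, EM)) (n := ∞).comp
    (contMDiffOn_id.prodMk hI) (fun x hx => eV.mem_target.mpr hx.1.2)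
  refine h0.congr fun x hx => ?_
  have h1 : (σ x).hom = A.ofCoord x₀ P x (A.toCoord x₀ P x (σ x).hom) :=
    (ofCoord_toCoord hx _ (σ x).ρ_comp_hom).symm
  -- A right inverse of the anchor is recovered from its coordinate `a`: in bundle charts it sends
  -- `v` to the preimage of `(v, a v)` under `(ρ, P)`, an expression smooth in `x`.
  have h2 : (σ x).hom (eT.symmL ℝ x v) = eV.symmL ℝ x (((A.coord x₀ x).prod P).inverse
      (v, A.toCoord x₀ P x (σ x).hom v)) := by
    conv_lhs => rw [h1]
    simp only [ofCoord, ContinuousLinearMap.comp_apply, ContinuousLinearMap.prod_apply]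
    rw [eT.continuousLinearMapAt_symmL hx.1.1]
    rfl
  rw [h2, eV.symmL_apply hx.1.2]
  exact eV.mk_symm hx.1.2 _

namespace VFSystem

variable (X : VFSystem EM F ES S V E)

/-- The horizontal lift of `C_σ` read in the tangent charts at `z`. -/
noncomputable def localHorLift (σ : ∀ x, ConnFibre X.toAnchor x) (z u : TotalSpace S E) : EM →L[ℝ] EM × ES :=
  ((trivializationAt (EM × ES) (TangentSpace (𝓘(ℝ, EM).prod 𝓘(ℝ, ES))) z).continuousLinearMapAt
    ℝ u).comp ((X.horLift σ u).comp
      ((trivializationAt EM (TangentSpace 𝓘(ℝ, EM)) z.proj).symmL ℝ u.proj))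

/-- This smoothness supplies the Lipschitz bound in the uniqueness proof. As `EM` is finite
dimensional, it can be tested on constant vectors `v`, where the map is `η` applied to a smooth
local section of `H`. -/
lemma contMDiffAt_localHorLift (σ : ∀ x, ConnFibre X.toAnchor x)
    (hσ : ContMDiff 𝓘(ℝ, EM) (𝓘(ℝ, EM).prod 𝓘(ℝ, ConnModel EM F)) ∞ (X.toBundle σ))
    (z : TotalSpace S E) :
    ContMDiffAt (𝓘(ℝ, EM).prod 𝓘(ℝ, ES)) 𝓘(ℝ, EM →L[ℝ] EM × ES) ∞ (X.localHorLift σ z) z := by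
  obtain ⟨U, hU, hzU, hs⟩ := X.toAnchor.exists_contMDiffOn_hom_symmL σ hσ z.proj
  set eT := trivializationAt EM (TangentSpace 𝓘(ℝ, EM) : M → Type _) z.proj
  set eE := trivializationAt (EM × ES)
    (TangentSpace (𝓘(ℝ, EM).prod 𝓘(ℝ, ES)) : TotalSpace S E → Type _) z
  have hp := SmoothFibreBundle.contMDiff_proj (S := S) 𝓘(ℝ, EM) 𝓘(ℝ, ES) E
  set W : Set (TotalSpace S E) := eE.baseSet ∩ (fun u => u.proj) ⁻¹' U
  have hW : IsOpen W := eE.open_baseSet.inter (hU.preimage hp.continuous)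
  have hzW : z ∈ W := ⟨mem_baseSet_trivializationAt _ _ z, hzU⟩
  refine ContMDiffOn.contMDiffAt ?_ (hW.mem_nhds hzW)
  refine contMDiffOn_clm_of_apply fun v => ?_
  have h1 : ContMDiffOn (𝓘(ℝ, EM).prod 𝓘(ℝ, ES)) ((𝓘(ℝ, EM).prod 𝓘(ℝ, ES)).prod 𝓘(ℝ, F)) ∞
      (fun u : TotalSpace S E => (⟨u, (σ u.proj).hom (eT.symmL ℝ u.proj v)⟩ : TotalSpace F
        ((bundleProj (S := S) 𝓘(ℝ, EM) 𝓘(ℝ, ES) E : TotalSpace S E → M) *ᵖ V))) W := by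
    intro u hu
    have h2 := ((hs v).comp hp.contMDiffOn (fun u hu => hu.2 : W ⊆ _)) u hu
    -- The fibre coordinate in the pullback of `H` to `E` is the one in `H` itself, so only the base
    -- component changes.
    rw [contMDiffWithinAt_totalSpace] at h2 ⊢
    exact ⟨contMDiffWithinAt_id, h2.2⟩
  have h3 : ContMDiffOn (𝓘(ℝ, EM).prod 𝓘(ℝ, ES)) (𝓘(ℝ, EM).prod 𝓘(ℝ, ES)).tangent ∞
      (fun u : TotalSpace S E => (⟨u, X.horLift σ u (eT.symmL ℝ u.proj v)⟩ :
        TangentBundle (𝓘(ℝ, EM).prod 𝓘(ℝ, ES)) (TotalSpace S E))) W :=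
    X.smooth_η.comp_contMDiffOn h1
  have h4 : ContMDiffOn (𝓘(ℝ, EM).prod 𝓘(ℝ, ES)).tangent
      ((𝓘(ℝ, EM).prod 𝓘(ℝ, ES)).prod 𝓘(ℝ, EM × ES)) ∞ eE eE.source := eE.contMDiffOn
  refine (contMDiff_snd.comp_contMDiffOn
    (h4.comp h3 (fun u hu => eE.mem_source.mpr hu.1))).congr fun u hu => ?_
  simp only [localHorLift, ContinuousLinearMap.comp_apply]
  exact eE.continuousLinearMapAt_apply_of_mem ℝ hu.1 _

/-- A horizontal curve satisfies, in the charts at `z`, the differential equation given by the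
horizontal lift. -/
lemma hasDerivAt_extChartAt_of_vertProj_eq_zero (σ : ∀ x, ConnFibre X.toAnchor x)
    {z : TotalSpace S E} {γ : ℝ → TotalSpace S E} {r : ℝ}
    (hγ : MDifferentiableAt 𝓘(ℝ, ℝ) (𝓘(ℝ, EM).prod 𝓘(ℝ, ES)) γ r)
    (hz : γ r ∈ (chartAt (ModelProd EM ES) z).source)
    (hz' : (γ r).proj ∈ (chartAt EM z.proj).source)
    (h : X.vertProj σ (γ r) (mfderiv 𝓘(ℝ, ℝ) (𝓘(ℝ, EM).prod 𝓘(ℝ, ES)) γ r (1 : ℝ)) = 0) :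
    HasDerivAt (fun s => extChartAt (𝓘(ℝ, EM).prod 𝓘(ℝ, ES)) z (γ s))
      (X.localHorLift σ z (γ r)
        (deriv (fun s => extChartAt 𝓘(ℝ, EM) z.proj (γ s).proj) r)) r := by
  set Y := mfderiv 𝓘(ℝ, ℝ) (𝓘(ℝ, EM).prod 𝓘(ℝ, ES)) γ r (1 : ℝ)
  have hp : MDifferentiableAt (𝓘(ℝ, EM).prod 𝓘(ℝ, ES)) 𝓘(ℝ, EM)
      (fun u : TotalSpace S E => u.proj) (γ r) :=
    (SmoothFibreBundle.contMDiff_proj 𝓘(ℝ, EM) 𝓘(ℝ, ES) E).mdifferentiableAt (by simp)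
  have hφ : MDifferentiableAt (𝓘(ℝ, EM).prod 𝓘(ℝ, ES)) 𝓘(ℝ, EM × ES)
      (extChartAt (𝓘(ℝ, EM).prod 𝓘(ℝ, ES)) z) (γ r) := mdifferentiableAt_extChartAt hz
  have hψ : MDifferentiableAt 𝓘(ℝ, EM) 𝓘(ℝ, EM) (extChartAt 𝓘(ℝ, EM) z.proj) (γ r).proj :=
    mdifferentiableAt_extChartAt hz'
  have h1 : HasDerivAt (fun s => extChartAt (𝓘(ℝ, EM).prod 𝓘(ℝ, ES)) z (γ s))
      (mfderiv (𝓘(ℝ, EM).prod 𝓘(ℝ, ES)) 𝓘(ℝ, EM × ES)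
        (extChartAt (𝓘(ℝ, EM).prod 𝓘(ℝ, ES)) z) (γ r) Y) r :=
    (hφ.hasMFDerivAt.comp r hγ.hasMFDerivAt).hasDerivAt_curve
  have h2 : HasDerivAt (fun s => extChartAt 𝓘(ℝ, EM) z.proj (γ s).proj)
      (mfderiv 𝓘(ℝ, EM) 𝓘(ℝ, EM) (extChartAt 𝓘(ℝ, EM) z.proj) (γ r).proj
        (mfderiv (𝓘(ℝ, EM).prod 𝓘(ℝ, ES)) 𝓘(ℝ, EM) (fun u : TotalSpace S E => u.proj) (γ r) Y)) r :=
    (hψ.hasMFDerivAt.comp r (hp.hasMFDerivAt.comp r hγ.hasMFDerivAt)).hasDerivAt_curve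
  -- Vanishing of `Φ_σ(Y) = Y - C_σ(Tp Y)` says that `Y` is the horizontal lift of its projection.
  have hY : Y = X.horLift σ (γ r) (mfderiv (𝓘(ℝ, EM).prod 𝓘(ℝ, ES)) 𝓘(ℝ, EM)
      (fun u : TotalSpace S E => u.proj) (γ r) Y) := sub_eq_zero.mp h
  have hsymm := Trivialization.symmL_continuousLinearMapAt (R := ℝ)
    (trivializationAt EM (TangentSpace 𝓘(ℝ, EM) : M → Type _) z.proj) hz'
    (mfderiv (𝓘(ℝ, EM).prod 𝓘(ℝ, ES)) 𝓘(ℝ, EM) (fun u : TotalSpace S E => u.proj) (γ r) Y)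
  -- The derivative of a chart is the corresponding trivialization of the tangent bundle, which is
  -- how `localHorLift` reads vectors.
  rw [← TangentBundle.continuousLinearMapAt_trivializationAt hz'] at h2
  rw [← TangentBundle.continuousLinearMapAt_trivializationAt hz, hY, ← hsymm] at h1
  rw [h2.deriv]
  exact h1

end VFSystem

end HorizontalLifts

/-! ### Uniqueness for the differential equation -/

/-- Two solutions of `w' = Λ(w) x'` with the same initial value agree if `Λ` is Lipschitz and `x'`
is bounded; the equation need not hold at the end points. -/
lemma eqOn_of_hasDerivAt_clm_apply {G W : Type*} [NormedAddCommGroup G] [NormedSpace ℝ G]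
    [NormedAddCommGroup W] [NormedSpace ℝ W] {Λ : W → G →L[ℝ] W} {K : NNReal} {s : Set W}
    (hΛ : LipschitzOnWith K Λ s) {x : ℝ → G} {C : NNReal} {a b : ℝ}
    (hx : ∀ r ∈ Ioo a b, ‖x r‖ ≤ C) {w₁ w₂ : ℝ → W}
    (h₁ : ContinuousOn w₁ (Icc a b)) (h₂ : ContinuousOn w₂ (Icc a b))
    (hd₁ : ∀ r ∈ Ioo a b, HasDerivAt w₁ (Λ (w₁ r) (x r)) r)
    (hd₂ : ∀ r ∈ Ioo a b, HasDerivAt w₂ (Λ (w₂ r) (x r)) r)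
    (hs₁ : ∀ r ∈ Ioo a b, w₁ r ∈ s) (hs₂ : ∀ r ∈ Ioo a b, w₂ r ∈ s) (h0 : w₁ a = w₂ a) :
    EqOn w₁ w₂ (Icc a b) := by
  intro t ht
  rcases eq_or_lt_of_le ht.1 with rfl | hat
  · exact h0
  have hv : ∀ r ∈ Ioo a b, LipschitzOnWith (K * C) (fun w => Λ w (x r)) s := by
    intro r hr
    refine LipschitzOnWith.of_dist_le_mul fun u hu v hv => ?_
    rw [dist_eq_norm, ← sub_apply]
    calc ‖(Λ u - Λ v) (x r)‖ ≤ ‖Λ u - Λ v‖ * ‖x r‖ := ContinuousLinearMap.le_opNorm _ _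
      _ ≤ (K * dist u v) * C := by
        gcongr
        · rw [← dist_eq_norm]; exact hΛ.dist_le_mul u hu v hv
        · exact hx r hr
      _ = ↑(K * C) * dist u v := by push_cast; ring
  -- Grönwall is applied from an interior time `r`, because the equation may fail at `a`; continuity
  -- then allows `r → a`, where the distance vanishes.
  have key : ∀ r ∈ Ioo a t, dist (w₁ t) (w₂ t) ≤
      dist (w₁ r) (w₂ r) * Real.exp (↑(K * C) * (t - r)) := by
    intro r hr
    have hsub : ∀ q ∈ Ico r b, q ∈ Ioo a b := fun q hq => ⟨hr.1.trans_le hq.1, hq.2⟩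
    exact dist_le_of_trajectories_ODE_of_mem (s := fun _ => s) (fun q hq => hv q (hsub q hq))
      (h₁.mono (Icc_subset_Icc_left hr.1.le)) (fun q hq => (hd₁ q (hsub q hq)).hasDerivWithinAt)
      (fun q hq => hs₁ q (hsub q hq))
      (h₂.mono (Icc_subset_Icc_left hr.1.le)) (fun q hq => (hd₂ q (hsub q hq)).hasDerivWithinAt)
      (fun q hq => hs₂ q (hsub q hq)) le_rfl t ⟨hr.2.le, ht.2⟩
  have hc : ContinuousWithinAt
      (fun r => dist (w₁ r) (w₂ r) * Real.exp (↑(K * C) * (t - r))) (Icc a b) a :=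
    ((h₁ a ⟨le_rfl, ht.1.trans ht.2⟩).dist (h₂ a ⟨le_rfl, ht.1.trans ht.2⟩)).mul
      (Continuous.continuousWithinAt (by fun_prop))
  have hlim : Filter.Tendsto (fun r => dist (w₁ r) (w₂ r) * Real.exp (↑(K * C) * (t - r)))
      (𝓝[Ioo a t] a) (𝓝 0) := by
    have := hc.mono_left (nhdsWithin_mono a
      (Ioo_subset_Icc_self.trans (Icc_subset_Icc_right ht.2) : Ioo a t ⊆ Icc a b))
    simpa [h0] using this
  have : (𝓝[Ioo a t] a).NeBot := left_nhdsWithin_Ioo_neBot hat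
  exact dist_le_zero.mp (ge_of_tendsto hlim (eventually_mem_nhdsWithin.mono key))

/-! ### Piecewise smooth curves -/

section PiecewiseSmoothCurves

variable {EY HY Y EZ HZ Z : Type*} [NormedAddCommGroup EY] [NormedSpace ℝ EY] [TopologicalSpace HY]
  [TopologicalSpace Y] [ChartedSpace HY Y] {IY : ModelWithCorners ℝ EY HY}
  [NormedAddCommGroup EZ] [NormedSpace ℝ EZ] [TopologicalSpace HZ]
  [TopologicalSpace Z] [ChartedSpace HZ Z] {IZ : ModelWithCorners ℝ EZ HZ}
  {γ : ℝ → Y} {t : ℝ} {K : Finset ℝ}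

lemma SmoothOffOn.mono {K' : Finset ℝ} (h : SmoothOffOn IY γ t K) (hK : K ⊆ K') :
    SmoothOffOn IY γ t K' :=
  ⟨h.1, fun a b ha hab hb hk => h.2 a b ha hab hb fun k hkK => hk k (hK hkK)⟩

lemma SmoothOffOn.contMDiff_comp {g : Y → Z} (hg : ContMDiff IY IZ ∞ g)
    (h : SmoothOffOn IY γ t K) : SmoothOffOn IZ (g ∘ γ) t K :=
  ⟨hg.continuous.comp_continuousOn h.1,
    fun a b ha hab hb hk => hg.comp_contMDiffOn (h.2 a b ha hab hb hk)⟩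

/-- Away from the finite set `K`, the point `r` has a compact interval as a neighbourhood that
avoids `K`, and the curve is smooth on it. -/
lemma SmoothOffOn.contMDiffAt (h : SmoothOffOn IY γ t K) {r : ℝ} (hr : r ∈ Ioo 0 t)
    (hrK : r ∉ K) : ContMDiffAt 𝓘(ℝ, ℝ) IY ∞ γ r := by
  have hmem : Ioo 0 t ∩ (K : Set ℝ)ᶜ ∈ 𝓝 r :=
    Filter.inter_mem (Ioo_mem_nhds hr.1 hr.2)
      (K.finite_toSet.isClosed.isOpen_compl.mem_nhds (by simpa using hrK))
  obtain ⟨a, b, hrab, hab, hsub⟩ := exists_Icc_mem_subset_of_mem_nhds hmem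
  have hab' : a ≤ b := hrab.1.trans hrab.2
  -- The interval is a neighbourhood of `r`, so it cannot be a single point.
  have hlt : a < b := by
    refine lt_of_le_of_ne hab' fun hEq => ?_
    subst hEq
    rw [Icc_self] at hab
    exact (Filter.nonempty_of_mem (Filter.inter_mem (mem_nhdsWithin_of_mem_nhds hab)
      (self_mem_nhdsWithin : Ioi r ∈ 𝓝[>] r))).elim fun x hx => by
        have h1 : x = a := hx.1
        have h2 : r = a := le_antisymm hrab.2 hrab.1
        exact absurd hx.2 (by simp [h1, h2])
  exact (h.2 a b (hsub (left_mem_Icc.mpr hab')).1.1.le hlt (hsub (right_mem_Icc.mpr hab')).1.2.le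
    fun k hk hkab => (hsub (Ioo_subset_Icc_self hkab)).2 hk).contMDiffAt hab

end PiecewiseSmoothCurves

/-! ### Uniqueness of horizontal lifts -/

section Systems

set_option linter.unusedSectionVars false

variable {EM M F ES S : Type*}
  [NormedAddCommGroup EM] [NormedSpace ℝ EM] [FiniteDimensional ℝ EM]
  [TopologicalSpace M] [ChartedSpace EM M] [IsManifold 𝓘(ℝ, EM) ∞ M]
  [NormedAddCommGroup F] [NormedSpace ℝ F] [FiniteDimensional ℝ F]
  {V : M → Type*} [∀ x, AddCommGroup (V x)] [∀ x, Module ℝ (V x)] [∀ x, TopologicalSpace (V x)]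
  [TopologicalSpace (TotalSpace F V)] [FiberBundle F V] [VectorBundle ℝ F V]
  [ContMDiffVectorBundle ∞ F V 𝓘(ℝ, EM)]
  [NormedAddCommGroup ES] [NormedSpace ℝ ES]
  [TopologicalSpace S] [ChartedSpace ES S] [IsManifold 𝓘(ℝ, ES) ∞ S]
  {E : M → Type*} [∀ x, TopologicalSpace (E x)]
  [TopologicalSpace (TotalSpace S E)] [FiberBundle S E]
  [SmoothFibreBundle 𝓘(ℝ, EM) 𝓘(ℝ, ES) S E]

namespace VFSystem

variable (X : VFSystem EM F ES S V E) {σ : ∀ x, ConnFibre X.toAnchor x}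

/-- For a short time after `a` both curves stay in the chart at their common value. There they solve
one equation `w' = Λ(w) x'`, with the same `x'` because they cover the same base curve. The time `a`
may be a break point. -/
lemma eventually_eq_of_horizontal
    (hσ : ContMDiff 𝓘(ℝ, EM) (𝓘(ℝ, EM).prod 𝓘(ℝ, ConnModel EM F)) ∞ (X.toBundle σ))
    {t : ℝ} {K : Finset ℝ} {γ₁ γ₂ : ℝ → TotalSpace S E}
    (hproj : ∀ r ∈ Icc 0 t, (γ₁ r).proj = (γ₂ r).proj)
    (hs₁ : SmoothOffOn (𝓘(ℝ, EM).prod 𝓘(ℝ, ES)) γ₁ t K)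
    (hs₂ : SmoothOffOn (𝓘(ℝ, EM).prod 𝓘(ℝ, ES)) γ₂ t K)
    (hh₁ : ∀ r ∈ Ioo 0 t, r ∉ K → X.vertProj σ (γ₁ r)
      (mfderiv 𝓘(ℝ, ℝ) (𝓘(ℝ, EM).prod 𝓘(ℝ, ES)) γ₁ r (1 : ℝ)) = 0)
    (hh₂ : ∀ r ∈ Ioo 0 t, r ∉ K → X.vertProj σ (γ₂ r)
      (mfderiv 𝓘(ℝ, ℝ) (𝓘(ℝ, EM).prod 𝓘(ℝ, ES)) γ₂ r (1 : ℝ)) = 0)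
    {a : ℝ} (ha : a ∈ Ico 0 t) (haz : γ₁ a = γ₂ a) :
    {r | γ₁ r = γ₂ r} ∈ 𝓝[>] a := by
  obtain ⟨z, hz⟩ : ∃ z, z = γ₁ a := ⟨_, rfl⟩
  set φ := extChartAt (𝓘(ℝ, EM).prod 𝓘(ℝ, ES)) z with hφdef
  set ψ := extChartAt 𝓘(ℝ, EM) z.proj with hψdef
  have hp := SmoothFibreBundle.contMDiff_proj (S := S) 𝓘(ℝ, EM) 𝓘(ℝ, ES) E
  have hφsymm : ContMDiffAt 𝓘(ℝ, EM × ES) (𝓘(ℝ, EM).prod 𝓘(ℝ, ES)) ∞ φ.symm (φ z) :=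
    (contMDiffOn_extChartAt_symm z).contMDiffAt (extChartAt_target_mem_nhds z)
  have hL : ContMDiffAt (𝓘(ℝ, EM).prod 𝓘(ℝ, ES)) 𝓘(ℝ, EM →L[ℝ] EM × ES) ∞
      (X.localHorLift σ z) (φ.symm (φ z)) := by
    rw [extChartAt_to_inv]; exact X.contMDiffAt_localHorLift σ hσ z
  have hΛ : ContDiffAt ℝ ∞ (fun w => X.localHorLift σ z (φ.symm w)) (φ z) :=
    (ContMDiffAt.comp (φ z) hL hφsymm).contDiffAt
  -- A `C¹` map is Lipschitz near a point; `s` is the neighbourhood of `φ z` in which both curves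
  -- have to be kept.
  obtain ⟨C, s, hs, hLip⟩ := (hΛ.of_le (by simp : (1 : WithTop ℕ∞) ≤ ∞)).exists_lipschitzOnWith
  have hN : {u : TotalSpace S E | (u ∈ (chartAt (ModelProd EM ES) z).source ∧
      u.proj ∈ (chartAt EM z.proj).source) ∧ φ u ∈ s} ∈ 𝓝 z :=
    Filter.inter_mem (Filter.inter_mem (chart_source_mem_nhds _ z)
      (hp.continuous.continuousAt (chart_source_mem_nhds EM z.proj)))
      (continuousAt_extChartAt z hs)
  have hcont : ∀ {γ : ℝ → TotalSpace S E}, ContinuousOn γ (Icc 0 t) → γ a = z →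
      γ ⁻¹' {u : TotalSpace S E | (u ∈ (chartAt (ModelProd EM ES) z).source ∧
        u.proj ∈ (chartAt EM z.proj).source) ∧ φ u ∈ s} ∈ 𝓝[≥] a := by
    intro γ hγ hγa
    have h1 := (hγ a ⟨ha.1, ha.2.le⟩).preimage_mem_nhdsWithin (by rw [hγa]; exact hN)
    have h2 : 𝓝[≥] a ≤ 𝓝[Icc 0 t] a := by
      rw [← nhdsWithin_Icc_eq_nhdsGE ha.2]
      exact nhdsWithin_mono _ (Icc_subset_Icc_left ha.1)
    exact h2 h1
  -- Erasing `a` permits a break at the left end; only the open interval `(a, b)` has to avoid `K`.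
  have hK : ((K.erase a : Finset ℝ) : Set ℝ)ᶜ ∈ 𝓝[≥] a :=
    mem_nhdsWithin_of_mem_nhds
      ((K.erase a).finite_toSet.isClosed.isOpen_compl.mem_nhds (by simp))
  obtain ⟨b, hab, hb⟩ := mem_nhdsGE_iff_exists_Icc_subset.mp
    (Filter.inter_mem (Filter.inter_mem (Icc_mem_nhdsGE ha.2) hK)
      (Filter.inter_mem (hcont hs₁.1 hz.symm) (hcont hs₂.1 (haz ▸ hz.symm))))
  have hab : a < b := hab
  have hbt : b ≤ t := (hb (right_mem_Icc.mpr hab.le)).1.1.2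
  have hIoo : ∀ r ∈ Ioo a b, r ∈ Ioo 0 t := fun r hr =>
    ⟨ha.1.trans_lt hr.1, hr.2.trans_le hbt⟩
  have hIooK : ∀ r ∈ Ioo a b, r ∉ K := fun r hr hrK =>
    (hb (Ioo_subset_Icc_self hr)).1.2 (Finset.mem_erase.mpr ⟨hr.1.ne', hrK⟩)
  have hd : ∀ {γ : ℝ → TotalSpace S E}, SmoothOffOn (𝓘(ℝ, EM).prod 𝓘(ℝ, ES)) γ t K →
      (∀ r ∈ Ioo 0 t, r ∉ K → X.vertProj σ (γ r)
        (mfderiv 𝓘(ℝ, ℝ) (𝓘(ℝ, EM).prod 𝓘(ℝ, ES)) γ r (1 : ℝ)) = 0) →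
      (∀ r ∈ Icc 0 t, (γ₁ r).proj = (γ r).proj) →
      (∀ r ∈ Icc a b, (γ r ∈ (chartAt (ModelProd EM ES) z).source ∧
        (γ r).proj ∈ (chartAt EM z.proj).source) ∧ φ (γ r) ∈ s) →
      ∀ r ∈ Ioo a b, HasDerivAt (fun q => φ (γ q)) (X.localHorLift σ z (φ.symm (φ (γ r)))
        (deriv (fun q => ψ (γ₁ q).proj) r)) r := by
    intro γ hγ hh hpr hch r hr
    have hr' := hch r (Ioo_subset_Icc_self hr)
    have h1 := X.hasDerivAt_extChartAt_of_vertProj_eq_zero σ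
      ((hγ.contMDiffAt (hIoo r hr) (hIooK r hr)).mdifferentiableAt (by simp))
      hr'.1.1 hr'.1.2 (hh r (hIoo r hr) (hIooK r hr))
    -- The driving term depends only on the projected curve, so the one of `γ₁` serves for both
    -- curves.
    have h2 : deriv (fun q => ψ (γ₁ q).proj) r = deriv (fun q => ψ (γ q).proj) r := by
      refine Filter.EventuallyEq.deriv_eq ?_
      filter_upwards [Ioo_mem_nhds hr.1 hr.2] with q hq
      rw [hpr q (Ioo_subset_Icc_self (hIoo q hq))]
    rw [h2, φ.left_inv (by rw [extChartAt_source]; exact hr'.1.1)]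
    exact h1
  have hw : ∀ {γ : ℝ → TotalSpace S E}, ContinuousOn γ (Icc 0 t) →
      (∀ r ∈ Icc a b, (γ r ∈ (chartAt (ModelProd EM ES) z).source ∧
        (γ r).proj ∈ (chartAt EM z.proj).source) ∧ φ (γ r) ∈ s) →
      ContinuousOn (fun r => φ (γ r)) (Icc a b) := by
    intro γ hγ hch
    refine (continuousOn_extChartAt z).comp (hγ.mono (Icc_subset_Icc ha.1 hbt)) fun r hr => ?_
    rw [extChartAt_source]
    exact (hch r hr).1.1
  have hch₁ := fun r hr => (hb (a := r) hr).2.1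
  have hch₂ := fun r hr => (hb (a := r) hr).2.2
  -- Piecewise smooth curves are smooth up to their break points from either side. So the base curve
  -- is smooth on the closed interval, and compactness bounds its derivative, even near a break at
  -- `a`.
  have hξ : ContDiffOn ℝ ∞ (fun q => ψ (γ₁ q).proj) (Icc a b) := by
    rw [← contMDiffOn_iff_contDiffOn]
    exact (contMDiffOn_extChartAt (I := 𝓘(ℝ, EM)) (x := z.proj)).comp
      (hp.comp_contMDiffOn (hs₁.2 a b ha.1 hab hbt fun k hk hk' => hIooK k hk' hk))
      (fun r hr => (hch₁ r hr).1.2)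
  obtain ⟨D, hD⟩ := isCompact_Icc.exists_bound_of_continuousOn
    (hξ.continuousOn_derivWithin (uniqueDiffOn_Icc hab) (by simp))
  have hD' : ∀ r ∈ Ioo a b, ‖deriv (fun q => ψ (γ₁ q).proj) r‖ ≤ D.toNNReal := by
    intro r hr
    rw [← derivWithin_of_mem_nhds (Icc_mem_nhds hr.1 hr.2)]
    exact (hD r (Ioo_subset_Icc_self hr)).trans (Real.le_coe_toNNReal D)
  have hEq := eqOn_of_hasDerivAt_clm_apply hLip hD' (hw hs₁.1 hch₁) (hw hs₂.1 hch₂)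
    (hd hs₁ hh₁ (fun _ _ => rfl) hch₁) (hd hs₂ hh₂ hproj hch₂)
    (fun r hr => (hch₁ r (Ioo_subset_Icc_self hr)).2)
    (fun r hr => (hch₂ r (Ioo_subset_Icc_self hr)).2) (congrArg φ haz)
  filter_upwards [Ioo_mem_nhdsGT hab] with r hr
  have hr' := Ioo_subset_Icc_self hr
  refine φ.injOn ?_ ?_ (hEq hr')
  · rw [extChartAt_source]; exact (hch₁ r hr').1.1
  · rw [extChartAt_source]; exact (hch₂ r hr').1.1

/-- Horizontal lifts are uniquely determined by their initial value. -/
lemma eq_of_isHorizontalLift [T2Space M] [T2Space S]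
    (hσ : ContMDiff 𝓘(ℝ, EM) (𝓘(ℝ, EM).prod 𝓘(ℝ, ConnModel EM F)) ∞ (X.toBundle σ))
    {c : ℝ → M} {t : ℝ} {u : TotalSpace S E} {γ₁ γ₂ : ℝ → TotalSpace S E}
    (h₁ : IsHorizontalLift (𝓘(ℝ, EM).prod 𝓘(ℝ, ES)) (fun u : TotalSpace S E => u.proj)
      (X.vertProj σ) c t u γ₁)
    (h₂ : IsHorizontalLift (𝓘(ℝ, EM).prod 𝓘(ℝ, ES)) (fun u : TotalSpace S E => u.proj)
      (X.vertProj σ) c t u γ₂) : EqOn γ₁ γ₂ (Icc 0 t) := by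
  classical
  obtain ⟨h01, hc1, K₁, hs1, hh1⟩ := h₁
  obtain ⟨h02, hc2, K₂, hs2, hh2⟩ := h₂
  have : T2Space (TotalSpace S E) := FiberBundle.t2Space_totalSpace
  have hclosed : IsClosed ({r | γ₁ r = γ₂ r} ∩ Icc 0 t) := by
    rw [inter_comm]
    exact (hs1.1.prodMk hs2.1).preimage_isClosed_of_isClosed isClosed_Icc isClosed_diagonal
  -- A closed subset of `[0, t]` that contains `0` and extends to the right of each of its points
  -- before `t` is everything. The union of the break sets serves both curves.
  exact hclosed.Icc_subset_of_forall_mem_nhdsWithin (h01.trans h02.symm) fun r hr =>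
    X.eventually_eq_of_horizontal hσ (K := K₁ ∪ K₂)
      (fun q hq => (hc1 q hq).trans (hc2 q hq).symm)
      (hs1.mono Finset.subset_union_left) (hs2.mono Finset.subset_union_right)
      (fun q hq hqK => hh1 q hq fun h => hqK (Finset.mem_union_left _ h))
      (fun q hq hqK => hh2 q hq fun h => hqK (Finset.mem_union_right _ h)) hr.2 hr.1

/-! ### Comparison of the universal connection with `C_σ` -/

/-- Such a `z` is a pair `(σ(x), u)` with `u` over `x`, so `u` determines it. The opposite
composite, `pr₂` after `extSection`, is the identity by definition. -/
lemma extSection_pr₂ {z : X.ConnPullback} {x : M} (hz : z.proj = X.toBundle σ x) :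
    X.extSection σ (X.pr₂ z) = z := by
  obtain ⟨_, y⟩ := z
  subst hz
  rfl

variable [∀ x, Nonempty (E x)]

/-- The core of the argument: `Φ^univ` subtracts `η(s(Tp_C X), u)`, and here `s = σ(x)` and `Tp_C X
= Tp Y`. It holds for every tangent vector at such a point, not only for those tangent to the image
of `σ ×_M E`. -/
lemma univVertProj_eq_vertProj {z : X.ConnPullback} (hz : z.proj = X.toBundle σ z.proj.proj)
    (Y : TangentSpace ((𝓘(ℝ, EM).prod 𝓘(ℝ, ConnModel EM F)).prod 𝓘(ℝ, ES)) z) :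
    X.univVertProj z Y = X.vertProj σ (X.pr₂ z)
      (mfderiv ((𝓘(ℝ, EM).prod 𝓘(ℝ, ConnModel EM F)).prod 𝓘(ℝ, ES))
        (𝓘(ℝ, EM).prod 𝓘(ℝ, ES)) X.pr₂ z Y) := by
  have hpr : MDifferentiableAt ((𝓘(ℝ, EM).prod 𝓘(ℝ, ConnModel EM F)).prod 𝓘(ℝ, ES))
      (𝓘(ℝ, EM).prod 𝓘(ℝ, ES)) X.pr₂ z :=
    (SmoothFibreBundle.contMDiff_pullbackLift X.connProj).mdifferentiableAt (by simp)
  have hp : MDifferentiableAt (𝓘(ℝ, EM).prod 𝓘(ℝ, ES)) 𝓘(ℝ, EM)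
      (fun u : TotalSpace S E => u.proj) (X.pr₂ z) :=
    (SmoothFibreBundle.contMDiff_proj 𝓘(ℝ, EM) 𝓘(ℝ, ES) E).mdifferentiableAt (by simp)
  have hq : MDifferentiableAt ((𝓘(ℝ, EM).prod 𝓘(ℝ, ConnModel EM F)).prod 𝓘(ℝ, ES))
      (𝓘(ℝ, EM).prod 𝓘(ℝ, ConnModel EM F)) (fun w : X.ConnPullback => w.proj) z :=
    (SmoothFibreBundle.contMDiff_proj (S := S) (𝓘(ℝ, EM).prod 𝓘(ℝ, ConnModel EM F)) 𝓘(ℝ, ES)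
      ((X.connProj : X.ConnBundle → M) *ᵖ E)).mdifferentiableAt (by simp)
  have hC : MDifferentiableAt (𝓘(ℝ, EM).prod 𝓘(ℝ, ConnModel EM F)) 𝓘(ℝ, EM) X.connProj z.proj :=
    X.connProj.contMDiff.mdifferentiableAt (by simp)
  -- The two composites `C(H) ×_M E → M` are the same map by definition; the chain rule is applied
  -- to each.
  have hcomp := (mfderiv_comp z hC hq).symm.trans
    (mfderiv_comp (g := fun u : TotalSpace S E => u.proj) z hp hpr)
  have hcompY := congrArg (fun D : _ →L[ℝ] _ => D Y) hcomp
  have hhom : z.proj.2 = σ z.proj.proj := by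
    obtain ⟨⟨x, s⟩, y⟩ := z
    exact eq_of_heq (TotalSpace.mk.inj hz).2
  change _ - X.η (X.pr₂ z) (z.proj.2.hom _) = _ - X.η (X.pr₂ z) ((σ z.proj.proj).hom _)
  rw [hhom]
  exact congrArg (fun ξ => _ - X.η (X.pr₂ z) ((σ z.proj.proj).hom ξ)) hcompY

/-- For a curve over `σ ∘ c` the two horizontality conditions agree pointwise. Smoothness of `pr₂ ∘
γ` does not by itself give that of `γ` for arbitrary `σ`; `hsm` provides it, and is obtained from `γ
= (σ ×_M E) ∘ pr₂ ∘ γ` on `[0, t]` when `σ` is smooth. -/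
lemma isHorizontalLift_pr₂_iff
    {c : ℝ → M} {t : ℝ} {z : X.ConnPullback} {γ : ℝ → X.ConnPullback} (hz : γ 0 = z)
    (hγ : ∀ r ∈ Icc 0 t, (γ r).proj = X.toBundle σ (c r))
    (hsm : ∀ K, SmoothOffOn (𝓘(ℝ, EM).prod 𝓘(ℝ, ES)) (X.pr₂ ∘ γ) t K →
      SmoothOffOn ((𝓘(ℝ, EM).prod 𝓘(ℝ, ConnModel EM F)).prod 𝓘(ℝ, ES)) γ t K) :
    IsHorizontalLift ((𝓘(ℝ, EM).prod 𝓘(ℝ, ConnModel EM F)).prod 𝓘(ℝ, ES))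
      (fun z : X.ConnPullback => z.proj) X.univVertProj (X.toBundle σ ∘ c) t z γ ↔
    IsHorizontalLift (𝓘(ℝ, EM).prod 𝓘(ℝ, ES)) (fun u : TotalSpace S E => u.proj)
      (X.vertProj σ) c t (X.pr₂ z) (X.pr₂ ∘ γ) := by
  have hpr : ContMDiff ((𝓘(ℝ, EM).prod 𝓘(ℝ, ConnModel EM F)).prod 𝓘(ℝ, ES))
      (𝓘(ℝ, EM).prod 𝓘(ℝ, ES)) ∞ X.pr₂ := SmoothFibreBundle.contMDiff_pullbackLift X.connProj
  have hΦ : ∀ K, SmoothOffOn ((𝓘(ℝ, EM).prod 𝓘(ℝ, ConnModel EM F)).prod 𝓘(ℝ, ES)) γ t K →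
      ∀ r ∈ Ioo 0 t, r ∉ K → X.univVertProj (γ r) (mfderiv 𝓘(ℝ, ℝ)
          ((𝓘(ℝ, EM).prod 𝓘(ℝ, ConnModel EM F)).prod 𝓘(ℝ, ES)) γ r (1 : ℝ)) =
        X.vertProj σ (X.pr₂ (γ r))
          (mfderiv 𝓘(ℝ, ℝ) (𝓘(ℝ, EM).prod 𝓘(ℝ, ES)) (X.pr₂ ∘ γ) r (1 : ℝ)) := by
    intro K hK r hr hrK
    have hr' := hγ r (Ioo_subset_Icc_self hr)
    rw [X.univVertProj_eq_vertProj (σ := σ) (by rw [hr']; rfl),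
      mfderiv_comp r (hpr.mdifferentiableAt (by simp))
        ((hK.contMDiffAt hr hrK).mdifferentiableAt (by simp))]
    rfl
  constructor
  · rintro ⟨-, -, K, hs, hh⟩
    exact ⟨congrArg X.pr₂ hz, fun r hr => congrArg (fun s : X.ConnBundle => s.proj) (hγ r hr), K,
      hs.contMDiff_comp hpr, fun r hr hrK => (hΦ K hs r hr hrK).symm.trans (hh r hr hrK)⟩
  · rintro ⟨-, -, K, hs, hh⟩
    exact ⟨hz, hγ, K, hsm K hs, fun r hr hrK => (hΦ K (hsm K hs) r hr hrK).trans (hh r hr hrK)⟩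

lemma contMDiff_extSection
    (hσ : ContMDiff 𝓘(ℝ, EM) (𝓘(ℝ, EM).prod 𝓘(ℝ, ConnModel EM F)) ∞ (X.toBundle σ)) :
    ContMDiff (𝓘(ℝ, EM).prod 𝓘(ℝ, ES)) ((𝓘(ℝ, EM).prod 𝓘(ℝ, ConnModel EM F)).prod 𝓘(ℝ, ES)) ∞
      (X.extSection σ) :=
  SmoothFibreBundle.contMDiff_pullback_of_comp X.connProj
    (hσ.comp (SmoothFibreBundle.contMDiff_proj 𝓘(ℝ, EM) 𝓘(ℝ, ES) E)) contMDiff_id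

/-- Lifts correspond under `pr₂` and `extSection`, which matches the domains. The values come from
independent choices of lifts and agree by uniqueness in `E`. -/
lemma univPt_extSection [T2Space M] [T2Space S]
    (hσ : ContMDiff 𝓘(ℝ, EM) (𝓘(ℝ, EM).prod 𝓘(ℝ, ConnModel EM F)) ∞ (X.toBundle σ))
    (c : ℝ → M) {t : ℝ} (ht : 0 ≤ t) (u : TotalSpace S E) :
    X.univPt (X.toBundle σ ∘ c) t (X.extSection σ u) = (X.Pt σ c t u).map (X.extSection σ) := by
  have hdown : ∀ γ, IsHorizontalLift ((𝓘(ℝ, EM).prod 𝓘(ℝ, ConnModel EM F)).prod 𝓘(ℝ, ES))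
      (fun z : X.ConnPullback => z.proj) X.univVertProj (X.toBundle σ ∘ c) t
        (X.extSection σ u) γ →
      IsHorizontalLift (𝓘(ℝ, EM).prod 𝓘(ℝ, ES)) (fun u : TotalSpace S E => u.proj)
        (X.vertProj σ) c t u (X.pr₂ ∘ γ) := by
    intro γ hγ
    refine (X.isHorizontalLift_pr₂_iff hγ.1 hγ.2.1 fun K hs => ?_).mp hγ
    -- Only on `[0, t]` is `γ` known to lie over `σ ∘ c`; its values elsewhere are arbitrary, so
    -- smoothness is transferred by congruence on subintervals.
    have hcongr : ∀ r ∈ Icc 0 t, γ r = (X.extSection σ ∘ X.pr₂ ∘ γ) r := fun r hr =>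
      (X.extSection_pr₂ (hγ.2.1 r hr)).symm
    have hs' := hs.contMDiff_comp (X.contMDiff_extSection hσ)
    exact ⟨hs'.1.congr hcongr, fun a b ha hab hb hk => (hs'.2 a b ha hab hb hk).congr
      fun r hr => hcongr r (Icc_subset_Icc ha hb hr)⟩
  have hup : ∀ γ, IsHorizontalLift (𝓘(ℝ, EM).prod 𝓘(ℝ, ES)) (fun u : TotalSpace S E => u.proj)
        (X.vertProj σ) c t u γ →
      IsHorizontalLift ((𝓘(ℝ, EM).prod 𝓘(ℝ, ConnModel EM F)).prod 𝓘(ℝ, ES))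
        (fun z : X.ConnPullback => z.proj) X.univVertProj (X.toBundle σ ∘ c) t
        (X.extSection σ u) (X.extSection σ ∘ γ) := fun γ hγ =>
    (X.isHorizontalLift_pr₂_iff (congrArg (X.extSection σ) hγ.1)
      (fun r hr => congrArg (X.toBundle σ) (hγ.2.1 r hr))
      fun K hs => hs.contMDiff_comp (γ := γ) (X.contMDiff_extSection hσ)).mpr hγ
  refine Part.ext' ⟨fun ⟨γ, hγ⟩ => ⟨_, hdown γ hγ⟩, fun ⟨γ, hγ⟩ => ⟨_, hup γ hγ⟩⟩ fun h₁ h₂ => ?_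
  have hγ₁ := Classical.choose_spec h₁
  have hγ₂ := Classical.choose_spec (p := fun γ => IsHorizontalLift (𝓘(ℝ, EM).prod 𝓘(ℝ, ES))
    (fun u : TotalSpace S E => u.proj) (X.vertProj σ) c t u γ) h₂
  have hmem : t ∈ Icc 0 t := ⟨ht, le_rfl⟩
  -- The chosen universal lift, projected to `E`, is compared with the chosen lift there.
  have hEq := X.eq_of_isHorizontalLift hσ (hdown _ hγ₁) hγ₂ hmem
  exact (X.extSection_pr₂ (hγ₁.2.1 t hmem)).symm.trans (congrArg (X.extSection σ) hEq)

end VFSystem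

end Systems

theorem lemma4p5 {EM M F ES S : Type*}
    [NormedAddCommGroup EM] [NormedSpace ℝ EM] [FiniteDimensional ℝ EM]
    [TopologicalSpace M] [T2Space M] [ChartedSpace EM M] [IsManifold 𝓘(ℝ, EM) ∞ M]
    [NormedAddCommGroup F] [NormedSpace ℝ F] [FiniteDimensional ℝ F]
    {V : M → Type*} [∀ x, AddCommGroup (V x)] [∀ x, Module ℝ (V x)] [∀ x, TopologicalSpace (V x)]
    [TopologicalSpace (TotalSpace F V)] [FiberBundle F V] [VectorBundle ℝ F V]
    [ContMDiffVectorBundle ∞ F V 𝓘(ℝ, EM)]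
    [NormedAddCommGroup ES] [NormedSpace ℝ ES] [FiniteDimensional ℝ ES]
    [TopologicalSpace S] [T2Space S] [ChartedSpace ES S] [IsManifold 𝓘(ℝ, ES) ∞ S]
    {E : M → Type*} [∀ x, TopologicalSpace (E x)] [∀ x, Nonempty (E x)]
    [TopologicalSpace (TotalSpace S E)] [FiberBundle S E]
    [SmoothFibreBundle 𝓘(ℝ, EM) 𝓘(ℝ, ES) S E]
    (X : VFSystem EM F ES S V E)
    (σ : ∀ x, ConnFibre X.toAnchor x)
    (hσ : ContMDiff 𝓘(ℝ, EM) (𝓘(ℝ, EM).prod 𝓘(ℝ, ConnModel EM F)) ∞ (X.toBundle σ))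
    (c : ℝ → M) (hc : PiecewiseSmooth 𝓘(ℝ, EM) c 1) (t : ℝ) (ht : t ∈ Icc (0 : ℝ) 1) :
    (∀ u : TotalSpace S E, u.proj = c 0 →
      X.univPt (X.toBundle σ ∘ c) t (X.extSection σ u) = (X.Pt σ c t u).map (X.extSection σ)) ∧
    (∀ z : X.ConnPullback, z.proj = X.toBundle σ (c 0) →
      (X.univPt (X.toBundle σ ∘ c) t z).map X.pr₂ = X.Pt σ c t (X.pr₂ z)) := by
  have h1 : ∀ u : TotalSpace S E, X.univPt (X.toBundle σ ∘ c) t (X.extSection σ u) =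
      (X.Pt σ c t u).map (X.extSection σ) := X.univPt_extSection hσ c ht.1
  refine ⟨fun u _ => h1 u, fun z hz => ?_⟩
  -- Over `σ(c 0)` one has `z = (σ ×_M E)(pr₂ z)`, so the first equation applies, and `pr₂ ∘ (σ ×_M
  -- E)` is the identity.
  conv_lhs => rw [← X.extSection_pr₂ hz, h1, Part.map_map]
  exact Part.map_id' (fun _ => rfl) _
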